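/- **Setting.** Let $N\ge 1$, $k\in\mathbb R^N$, $\mathbf A,\mathbf B\in\mathbb R^{N\times N}$, $T>0$, $\alpha<\beta$, and $\mathbf M x=\sum_{j=0}^{N-1}m_jx_{j+1}$ with $m_0\ne0$. Let $0<s<1$, $1<p<\min\{\frac1s,\frac1{1-s}\}$ and $0<\sigma\le T/3$. Put $\mathbb L_p(a,b)=L_p(a,b)^N$, let $\mathbb W_p^s(a,b)$ be the Sobolev–Slobodeckij space with norm $$\|\varphi\|_{L_p(a,b)}+\Big(\int_a^b\!\int_a^b\frac{|\varphi(t)-\varphi(\xi)|^p}{|t-\xi|^{1+sp}}\,d\xi\,dt\Big)^{1/p},$$ and let $\mathbb B=\mathbb L_p(-2T,0)\cap\mathbb W^s_p(-T-\sigma,0)$ with the sum of the two norms. For continuous $g$ on $[0,\infty)$ let the nonideal relay be given by $\mathcal H(g)(0)=1$ if $g(0)<\beta$ and $\mathcal H(g)(0)=-1$ otherwise; for $t>0$ and $X_t=\{t'\in(0,t]: g(t')\in\{\alpha,\beta\}\}$, $\mathcal H(g)(t)=\mathcal H(g)(0)$ if $X_t=\emptyset$, and otherwise $\mathcal H(g)(t)=1$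 or $-1$ according to whether $g(\max X_t)=\alpha$ or $\beta$. Consider $$u'(t)=k\,\mathcal H(\mathbf Mu)(t)-\mathbf Bu(t)+\mathbf Au(t-2T)\ (t>0),\qquad u|_{(-2T,0)}=\varphi,\qquad u(0+)=x,$$ where solutions lie in $\mathbb L_p(-2T,T_1)\cap W^1_p(0,T_1)^N$ for every $T_1>0$. Assume that $(\varphi_\alpha,x_\alpha)\in\mathbb B\times\mathbb R^N$ generates a $2T$-periodic solution $u$ (that is, $u(2T)=x_\alpha$, $u(2T+\xi)=\varphi_\alpha(\xi)$ for $\xi\in(-2T,0)$, and $\mathcal H(\mathbf Mu)(2T)=\mathcal H(\mathbf Mu)(0)$) such that: $\mathbf Mx_\alpha=\alpha$; the switching times (discontinuities of $\mathcal H(\mathbf Mu)$) in $(0,2T]$ are exactly $T$ and $2T$, with $\mathbf Mu(T)=\beta$ and $\mathbf Mu(2T)=\alpha$; $\varphi_\alpha'(\theta)=-\varphi_\alpha'(\theta+T)$ for $\theta\in(-2T,-T)$; and the left derivatives of $\mathbf Mu$ at $T$ and $2T$ are nonzero. **Operators.** All spaces and operators below are complexified. Let $\mathbf E^{\mathbb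 R}:\mathbb C^N\to\mathbb C^{N-1}$ drop the first coordinate and let $D\mathbf Rz=\big(-\frac1{m_0}\sum_{j=1}^{N-1}m_jz_j,\,z\big)$. Let $\varphi_\alpha'(-T-)$ be the limit of $\varphi_\alpha'$ at $-T$ from the left. For $(\nu,y)\in\mathbb B\times\mathbb C^N$ set $$c(\nu,y)=-\frac{\mathbf M\big[\int_{-T}^0e^{\mathbf B\xi}\mathbf A\nu(\xi-T)\,d\xi+e^{-\mathbf BT}y\big]}{\mathbf M[\varphi_\alpha'(-T-)]},$$ $$\mathbf L[\nu,y](\theta)=\begin{cases}c(\nu,y)\,\varphi_\alpha'(\theta+T)+\nu(\theta+T),&\theta\in(-2T,-T),\\ c(\nu,y)\,\varphi_\alpha'(\theta-T)+\int_{-T}^\theta e^{\mathbf B(\xi-\theta)}\mathbf A\nu(\xi-T)\,d\xi+e^{-\mathbf B(\theta+T)}y,&\theta\in(-T,0),\end{cases}$$ $$\mathbf L_\Pi[\nu,z]=\big(\mathbf L[\nu,D\mathbf Rz],\ \mathbf E^{\mathbb R}\,\mathbf L[\nu,D\mathbf Rz](0)\big),\qquad (\nu,z)\in\mathbb B\times\mathbb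 C^{N-1},$$ where the value at $0$ is the limit from the left. On $Y=\mathbb L_p(-T,0)\times\mathbb L_p(-T,0)\times\mathbb C^{N-1}$ set $\mathbf V\nu_1(\theta)=\int_{-T}^\theta e^{\mathbf B(\xi-\theta)}\mathbf A\nu_1(\xi)\,d\xi$, $\mathcal V(\nu_1,\nu_2,z)=(\nu_2,\mathbf V\nu_1,0)$, and, with $$c=-\frac{\mathbf M\big[\int_{-T}^0e^{\mathbf B\xi}\mathbf A\nu_1(\xi)\,d\xi+e^{-\mathbf BT}D\mathbf Rz\big]}{\mathbf M[\varphi_\alpha'(-T-)]},$$ $$\mathcal F(\nu_1,\nu_2,z)=\Big(c\,\varphi_\alpha'(\cdot),\ c\,\varphi_\alpha'(\cdot-T)+e^{-\mathbf B(\cdot+T)}D\mathbf Rz,\ \mathbf E^{\mathbb R}\big[(\mathbf V\nu_1)(0)+c\,\varphi_\alpha'(-T-)+e^{-\mathbf BT}D\mathbf Rz\big]\Big).$$ For $\lambda\ne0$ define $\mathcal M(\lambda):\operatorname{Range}\mathcal F\to\operatorname{Range}\mathcal F$ by $\mathcal M(\lambda)=\mathcal I-\mathcal F(\lambda\mathcal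 I-\mathcal V)^{-1}$. **Corollary.** $\mathbf L_\Pi$ is a well-defined bounded linear operator on $\mathbb B\times\mathbb C^{N-1}$. For every complex $\lambda\neq0$, the operator $\lambda\mathcal I-\mathcal V$ is invertible on $Y$, and $\lambda\in\sigma(\mathbf L_\Pi)$ if and only if $\operatorname{Ker}\mathcal M(\lambda)$ is nontrivial. -/

import Mathlib

open MeasureTheory Set Filter Topology
open scoped ENNReal

noncomputable section

namespace HystDelay

/-! ### Fractional Sobolev-Slobodeckij spaces on intervals -/

section Spaces

variable {E : Type*} [NormedAddCommGroup E]

/-- Lebesgue measure on the interval `(a, b)`. -/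
abbrev volIoo (a b : ℝ) : Measure ℝ := volume.restrict (Ioo a b)

/-- The difference quotient `(f t - f ξ) / |t - ξ| ^ (1 / p + s)`.  The `p`-th power of its norm is
`|f t - f ξ| ^ p / |t - ξ| ^ (1 + s p)`, so that its `L_p` norm over `(a, b) × (a, b)` is the
Sobolev-Slobodeckij seminorm of `f` on `(a, b)`. -/
def slobQuot [NormedSpace ℝ E] (p s : ℝ) (f : ℝ → E) (z : ℝ × ℝ) : E :=
  (|z.1 - z.2| ^ (-(1 / p + s))) • (f z.1 - f z.2)

/-- `f ∈ W_p^s(a, b)`. -/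
def MemWsp [NormedSpace ℝ E] (p s a b : ℝ) (f : ℝ → E) : Prop :=
  MemLp f (ENNReal.ofReal p) (volIoo a b) ∧
    MemLp (slobQuot p s f) (ENNReal.ofReal p) ((volIoo a b).prod (volIoo a b))

/-- `u` is the (absolutely) continuous representative of an element of `W_p^1(a, b)` whose weak
derivative is `g`. -/
def IsW1p [NormedSpace ℝ E] (p a b : ℝ) (u g : ℝ → E) : Prop :=
  MemLp u (ENNReal.ofReal p) (volIoo a b) ∧ MemLp g (ENNReal.ofReal p) (volIoo a b) ∧
    ∀ t ∈ Icc a b, u t = u a + ∫ ξ in a..t, g ξ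

end Spaces

/-! ### The nonideal relay -/

/-- The hysteresis operator (nonideal relay) with thresholds `α < β`, applied to a function `g` on
`[0, ∞)` and evaluated at `t`.  The set `X` collects the times in `(0, t]` at which `g` takes the
value `α` or `β`; its supremum is a maximum when `g` is continuous and `X` is nonempty. -/
def relay (α β : ℝ) (g : ℝ → ℝ) (t : ℝ) : ℝ :=
  let X : Set ℝ := {t' | t' ∈ Ioc 0 t ∧ (g t' = α ∨ g t' = β)}
  open Classical in
  if X.Nonempty then (if g (sSup X) = α then 1 else -1)
  else (if g 0 < β then 1 else -1)

/-! ### The system and its periodic solution -/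

/-- The data of the equation `u'(t) = k H(M u)(t) - B u(t) + A u(t - 2T)` in dimension `N = n + 1`,
together with the exponents `p, s` and the number `σ` that enter the function spaces. -/
structure System (n : ℕ) where
  /-- coefficients of the linear functional `M` -/
  m : Fin (n + 1) → ℝ
  m_zero_ne : m 0 ≠ 0
  k : Fin (n + 1) → ℝ
  A : Matrix (Fin (n + 1)) (Fin (n + 1)) ℝ
  B : Matrix (Fin (n + 1)) (Fin (n + 1)) ℝ
  /-- half of the delay -/
  T : ℝ
  T_pos : 0 < T
  α : ℝ
  β : ℝ
  α_lt_β : α < β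
  p : ℝ
  s : ℝ
  s_pos : 0 < s
  s_lt_one : s < 1
  one_lt_p : 1 < p
  p_lt : p < min (1 / s) (1 / (1 - s))
  σ : ℝ
  σ_pos : 0 < σ
  σ_le : σ ≤ T / 3

variable {n : ℕ}

/-- The exponent `p` as an extended nonnegative real. -/
abbrev System.q (S : System n) : ℝ≥0∞ := ENNReal.ofReal S.p

instance System.fact_one_le_q (S : System n) : Fact (1 ≤ S.q) :=
  ⟨by simpa using ENNReal.ofReal_le_ofReal S.one_lt_p.le⟩

/-- The functional `M` on real vectors. -/
def System.M (S : System n) (x : Fin (n + 1) → ℝ) : ℝ := ∑ j, S.m j * x j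

/-- `f ∈ 𝔹`, that is, `f ∈ L_p(-2T, 0)` and `f ∈ W_p^s(-T-σ, 0)`. -/
def System.MemB (S : System n) {E : Type*} [NormedAddCommGroup E] [NormedSpace ℝ E]
    (f : ℝ → E) : Prop :=
  MemLp f S.q (volIoo (-2 * S.T) 0) ∧ MemWsp S.p S.s (-S.T - S.σ) 0 f

/-- `u` is a solution on `[-2T, ∞)` with initial data `(φ, x)`; on `[0, ∞)` the function `u` is the
continuous representative. -/
def System.IsSolution (S : System n) (φ : ℝ → Fin (n + 1) → ℝ) (x : Fin (n + 1) → ℝ)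
    (u : ℝ → Fin (n + 1) → ℝ) : Prop :=
  ∀ T₁ > 0, MemLp u S.q (volIoo (-2 * S.T) T₁) ∧
    (∃ g : ℝ → Fin (n + 1) → ℝ, IsW1p S.p 0 T₁ u g ∧
      ∀ᵐ t ∂volIoo 0 T₁, g t =
        relay S.α S.β (fun r => S.M (u r)) t • S.k - S.B.mulVec (u t)
          + S.A.mulVec (u (t - 2 * S.T))) ∧
    (∀ᵐ t ∂volIoo (-2 * S.T) 0, u t = φ t) ∧
    u 0 = x

/-- A `2T`-periodic solution with initial data `(φ, x) ∈ 𝔹 × ℝ^N` that starts on `M x = α`, switches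
exactly at `T` and `2T` along its period, has an anti-symmetric derivative, and switches
transversally.  Here `θ ↦ u (2T + θ)` is the continuous representative of `φ`. -/
structure PeriodicSolution (S : System n) where
  φ : ℝ → Fin (n + 1) → ℝ
  x : Fin (n + 1) → ℝ
  u : ℝ → Fin (n + 1) → ℝ
  φ_mem : S.MemB φ
  isSolution : S.IsSolution φ x u
  periodic_x : u (2 * S.T) = x
  periodic_φ : ∀ᵐ ξ ∂volIoo (-2 * S.T) 0, u (2 * S.T + ξ) = φ ξ
  periodic_relay : relay S.α S.β (fun r => S.M (u r)) (2 * S.T)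
    = relay S.α S.β (fun r => S.M (u r)) 0
  M_x : S.M x = S.α
  switching : {t ∈ Ioc 0 (2 * S.T) | ¬ ContinuousAt (relay S.α S.β (fun r => S.M (u r))) t}
    = {S.T, 2 * S.T}
  M_u_T : S.M (u S.T) = S.β
  M_u_two_T : S.M (u (2 * S.T)) = S.α
  antisymm : ∀ θ ∈ Ioo (-2 * S.T) (-S.T),
    deriv (fun r => u (2 * S.T + r)) θ = -deriv (fun r => u (2 * S.T + r)) (θ + S.T)
  transverse_T : derivWithin (fun r => S.M (u r)) (Iic S.T) S.T ≠ 0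
  transverse_two_T : derivWithin (fun r => S.M (u r)) (Iic (2 * S.T)) (2 * S.T) ≠ 0

/-! ### Complexified objects -/

/-- Complexification of a real vector. -/
def toC {ι : Type*} (v : ι → ℝ) : ι → ℂ := fun i => (v i : ℂ)

/-- The functional `M` on complex vectors. -/
def System.MC (S : System n) (y : Fin (n + 1) → ℂ) : ℂ := ∑ j, (S.m j : ℂ) * y j

/-- The matrix `A`, acting on complex vectors. -/
def System.AC (S : System n) : Matrix (Fin (n + 1)) (Fin (n + 1)) ℂ := S.A.map Complex.ofReal

/-- The matrix `e^{t B}`, acting on complex vectors. -/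
def System.expB (S : System n) (t : ℝ) : Matrix (Fin (n + 1)) (Fin (n + 1)) ℂ :=
  NormedSpace.exp (t • S.B.map Complex.ofReal)

/-- The derivative of the lift operators:
`z ↦ (-(1 / m₀) ∑ m_j z_j, z)`. -/
def System.DR (S : System n) (z : Fin n → ℂ) : Fin (n + 1) → ℂ :=
  Fin.cons (-(1 / (S.m 0 : ℂ)) * ∑ j, (S.m j.succ : ℂ) * z j) z

/-- The projection forgetting the first coordinate. -/
def projR (y : Fin (n + 1) → ℂ) : Fin n → ℂ := fun j => y j.succ

/-- The derivative `φ_α'` on `(-2T, -T)` and `(-T, 0)`. -/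
def PeriodicSolution.dphi {S : System n} (P : PeriodicSolution S) (θ : ℝ) : Fin (n + 1) → ℂ :=
  toC (deriv (fun r => P.u (2 * S.T + r)) θ)

/-- The limit of `φ_α'` at `-T` from the left. -/
def PeriodicSolution.dphiLeft {S : System n} (P : PeriodicSolution S) : Fin (n + 1) → ℂ :=
  limUnder (𝓝[<] (-S.T)) P.dphi

/-! ### The space `𝔹` (complexified) as a normed space -/

/-- Lebesgue space of `ℂ^N`-valued functions on `(a, b)`. -/
abbrev System.LpC (S : System n) (a b : ℝ) : Type := Lp (Fin (n + 1) → ℂ) S.q (volIoo a b)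

section BSpace

variable {E : Type*} [NormedAddCommGroup E] [NormedSpace ℝ E]

theorem slobQuot_add (p s : ℝ) (f g : ℝ → E) :
    slobQuot p s (f + g) = slobQuot p s f + slobQuot p s g := by
  funext z
  simp only [slobQuot, Pi.add_apply, ← smul_add]
  congr 1
  abel

theorem slobQuot_smul [NormedSpace ℂ E] (p s : ℝ) (c : ℂ) (f : ℝ → E) :
    slobQuot p s (c • f) = c • slobQuot p s f := by
  funext z
  simp only [slobQuot, Pi.smul_apply, ← smul_sub]
  exact smul_comm _ _ _

theorem slobQuot_congr (p s : ℝ) {μ : Measure ℝ} [SFinite μ] {f g : ℝ → E} (h : f =ᵐ[μ] g) :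
    slobQuot p s f =ᵐ[μ.prod μ] slobQuot p s g := by
  have h1 := Measure.quasiMeasurePreserving_fst (μ := μ) (ν := μ) |>.ae_eq_comp h
  have h2 := Measure.quasiMeasurePreserving_snd (μ := μ) (ν := μ) |>.ae_eq_comp h
  filter_upwards [h1, h2] with z hz1 hz2
  simp only [Function.comp_apply] at hz1 hz2
  simp only [slobQuot, hz1, hz2]

theorem aestronglyMeasurable_slobQuot (p s : ℝ) {μ : Measure ℝ} [SFinite μ] {f : ℝ → E}
    (h : AEStronglyMeasurable f μ) : AEStronglyMeasurable (slobQuot p s f) (μ.prod μ) := by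
  refine AEStronglyMeasurable.smul ?_ (h.comp_fst.sub h.comp_snd)
  exact (by fun_prop : Measurable fun z : ℝ × ℝ => |z.1 - z.2| ^ (-(1 / p + s)))
    |>.aestronglyMeasurable

end BSpace

namespace System

variable (S : System n)

theorem volIoo_le : volIoo (-S.T - S.σ) 0 ≤ volIoo (-2 * S.T) 0 := by
  refine Measure.restrict_mono (Ioo_subset_Ioo_left ?_) le_rfl
  have := S.σ_le
  have := S.T_pos
  linarith

theorem ae_volIoo {P : ℝ → Prop} (h : ∀ᵐ t ∂volIoo (-2 * S.T) 0, P t) :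
    ∀ᵐ t ∂volIoo (-S.T - S.σ) 0, P t :=
  S.volIoo_le.absolutelyContinuous.ae_le h

/-- `𝔹` as a linear subspace of `L_p(-2T, 0)`. -/
def BSub : Submodule ℂ (S.LpC (-2 * S.T) 0) where
  carrier := {f | S.MemB f}
  zero_mem' := by
    have h : ∀ᵐ t ∂volIoo (-2 * S.T) 0, (0 : S.LpC (-2 * S.T) 0) t = 0 := Lp.coeFn_zero _ _ _
    have h' := S.ae_volIoo h
    refine ⟨Lp.memLp _, (memLp_congr_ae h').2 ?_, ?_⟩
    · exact MemLp.zero'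
    · refine (memLp_congr_ae (slobQuot_congr S.p S.s (g := fun _ => 0) h')).2 ?_
      have : slobQuot S.p S.s (fun _ : ℝ => (0 : Fin (n + 1) → ℂ)) = fun _ => 0 := by
        funext z; simp [slobQuot]
      rw [this]
      exact MemLp.zero'
  add_mem' := by
    intro f g hf hg
    have h' := S.ae_volIoo (Lp.coeFn_add f g)
    refine ⟨Lp.memLp _, (memLp_congr_ae h').2 (hf.2.1.add hg.2.1), ?_⟩
    refine (memLp_congr_ae (slobQuot_congr S.p S.s h')).2 ?_
    rw [slobQuot_add]
    exact hf.2.2.add hg.2.2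
  smul_mem' := by
    intro c f hf
    have h' := S.ae_volIoo (Lp.coeFn_smul c f)
    refine ⟨Lp.memLp _, (memLp_congr_ae h').2 (hf.2.1.const_smul c), ?_⟩
    refine (memLp_congr_ae (slobQuot_congr S.p S.s h')).2 ?_
    rw [slobQuot_smul]
    exact hf.2.2.const_smul c

/-- The space `𝔹 = L_p(-2T, 0) ∩ W_p^s(-T-σ, 0)` of `ℂ^N`-valued functions. -/
def BSpace : Type := S.BSub

instance : AddCommGroup S.BSpace := inferInstanceAs (AddCommGroup S.BSub)

instance : Module ℂ S.BSpace := inferInstanceAs (Module ℂ S.BSub)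

variable {S}

/-- The underlying element of `L_p(-2T, 0)`. -/
def BSpace.toLp (f : S.BSpace) : S.LpC (-2 * S.T) 0 := Subtype.val f

theorem BSpace.memB (f : S.BSpace) : S.MemB f.toLp := Subtype.property f

theorem BSpace.toLp_add (f g : S.BSpace) : (f + g).toLp = f.toLp + g.toLp := rfl

theorem BSpace.toLp_smul (c : ℂ) (f : S.BSpace) : (c • f).toLp = c • f.toLp := rfl

/-- `‖f‖_𝔹 = ‖f‖_{L_p(-2T, 0)} + ‖f‖_{W_p^s(-T-σ, 0)}`, where the second norm is the sum of the
`L_p` norm and of the Sobolev-Slobodeckij seminorm. -/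
instance : Norm S.BSpace where
  norm f := (eLpNorm f.toLp S.q (volIoo (-2 * S.T) 0)).toReal +
    ((eLpNorm f.toLp S.q (volIoo (-S.T - S.σ) 0)).toReal +
      (eLpNorm (slobQuot S.p S.s f.toLp) S.q
        ((volIoo (-S.T - S.σ) 0).prod (volIoo (-S.T - S.σ) 0))).toReal)

theorem BSpace.norm_def (f : S.BSpace) :
    ‖f‖ = (eLpNorm f.toLp S.q (volIoo (-2 * S.T) 0)).toReal +
    ((eLpNorm f.toLp S.q (volIoo (-S.T - S.σ) 0)).toReal +
      (eLpNorm (slobQuot S.p S.s f.toLp) S.q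
        ((volIoo (-S.T - S.σ) 0).prod (volIoo (-S.T - S.σ) 0))).toReal) := rfl

theorem toReal_eLpNorm_add_le {X : Type*} [MeasurableSpace X] {μ : Measure X} {E : Type*}
    [NormedAddCommGroup E] {f g : X → E} (hf : MemLp f S.q μ) (hg : MemLp g S.q μ) :
    (eLpNorm (f + g) S.q μ).toReal ≤ (eLpNorm f S.q μ).toReal + (eLpNorm g S.q μ).toReal := by
  rw [← ENNReal.toReal_add hf.eLpNorm_ne_top hg.eLpNorm_ne_top]
  exact ENNReal.toReal_mono (ENNReal.add_ne_top.2 ⟨hf.eLpNorm_ne_top, hg.eLpNorm_ne_top⟩)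
    (eLpNorm_add_le hf.1 hg.1 S.fact_one_le_q.out)

theorem BSpace.core : NormedSpace.Core ℂ S.BSpace where
  norm_nonneg f := by rw [BSpace.norm_def]; positivity
  norm_smul c f := by
    have h := Lp.coeFn_smul c f.toLp
    have h' := S.ae_volIoo h
    have hc : ‖c‖ = (‖c‖ₑ).toReal := by simp
    simp only [BSpace.norm_def, BSpace.toLp_smul]
    rw [eLpNorm_congr_ae h, eLpNorm_congr_ae (show _ =ᵐ[volIoo (-S.T - S.σ) 0] _ from h'),
      eLpNorm_congr_ae (slobQuot_congr S.p S.s h'), slobQuot_smul, eLpNorm_const_smul,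
      eLpNorm_const_smul, eLpNorm_const_smul, ENNReal.toReal_mul, ENNReal.toReal_mul,
      ENNReal.toReal_mul, ← hc]
    ring
  norm_triangle f g := by
    have h := Lp.coeFn_add f.toLp g.toLp
    have h' := S.ae_volIoo h
    simp only [BSpace.norm_def, BSpace.toLp_add]
    rw [eLpNorm_congr_ae h, eLpNorm_congr_ae (show _ =ᵐ[volIoo (-S.T - S.σ) 0] _ from h'),
      eLpNorm_congr_ae (slobQuot_congr S.p S.s h'), slobQuot_add]
    have h1 := toReal_eLpNorm_add_le f.memB.1 g.memB.1
    have h2 := toReal_eLpNorm_add_le f.memB.2.1 g.memB.2.1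
    have h3 := toReal_eLpNorm_add_le f.memB.2.2 g.memB.2.2
    linarith
  norm_eq_zero_iff f := by
    constructor
    · intro h
      rw [BSpace.norm_def] at h
      have h0 : (eLpNorm f.toLp S.q (volIoo (-2 * S.T) 0)).toReal = 0 := by
        exact le_antisymm ((le_add_of_nonneg_right (by positivity)).trans h.le)
          ENNReal.toReal_nonneg
      have h1 : ‖f.toLp‖ = 0 := by rw [Lp.norm_def]; exact h0
      exact Subtype.ext (norm_eq_zero.1 h1)
    · rintro rfl
      have h : ∀ᵐ t ∂volIoo (-2 * S.T) 0, (0 : S.BSpace).toLp t = 0 := Lp.coeFn_zero _ _ _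
      have h' := S.ae_volIoo h
      have hz : slobQuot S.p S.s (fun _ : ℝ => (0 : Fin (n + 1) → ℂ)) = fun _ => 0 := by
        funext z; simp [slobQuot]
      rw [BSpace.norm_def, eLpNorm_congr_ae (g := fun _ => 0) h,
        eLpNorm_congr_ae (g := fun _ => 0) (show _ =ᵐ[volIoo (-S.T - S.σ) 0] _ from h'),
        eLpNorm_congr_ae (slobQuot_congr S.p S.s (g := fun _ => 0) h'), hz]
      simp

instance : NormedAddCommGroup S.BSpace := NormedAddCommGroup.ofCore BSpace.core

instance : NormedSpace ℂ S.BSpace := NormedSpace.ofCore BSpace.core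

end System

/-! ### The formal linearization -/

section Linearization

variable {S : System n} (P : PeriodicSolution S)

/-- The derivative of `(φ, x) ↦ M u_+(φ, x; T)` in the direction `(ν, y)`. -/
def System.duDir (S : System n) (ν : ℝ → Fin (n + 1) → ℂ) (y : Fin (n + 1) → ℂ) : ℂ :=
  S.MC ((∫ ξ in (-S.T)..0, (S.expB ξ).mulVec (S.AC.mulVec (ν (ξ - S.T))))
    + (S.expB (-S.T)).mulVec y)

/-- The derivative of the hit time operator at the periodic solution in the direction `(ν, y)`. -/
def PeriodicSolution.dHit (ν : ℝ → Fin (n + 1) → ℂ) (y : Fin (n + 1) → ℂ) : ℂ :=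
  -(S.MC P.dphiLeft)⁻¹ * S.duDir ν y

/-- The derivative of the flow in the direction `(ν, y)` at time `T`, as a function on `(-2T, 0)`. -/
def System.dFlow (S : System n) (ν : ℝ → Fin (n + 1) → ℂ) (y : Fin (n + 1) → ℂ) (θ : ℝ) :
    Fin (n + 1) → ℂ :=
  if θ < -S.T then ν (θ + S.T)
  else (∫ ξ in (-S.T)..θ, (S.expB (ξ - θ)).mulVec (S.AC.mulVec (ν (ξ - S.T))))
    + (S.expB (-(θ + S.T))).mulVec y

/-- The derivative of the flow with respect to time at time `T`, as a function on `(-2T, 0)`. -/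
def PeriodicSolution.dtFlow (θ : ℝ) : Fin (n + 1) → ℂ :=
  if θ < -S.T then P.dphi (θ + S.T) else P.dphi (θ - S.T)

/-- The formal linearization `L[ν, y]`, as a function on `(-2T, 0)`. -/
def PeriodicSolution.linFun (ν : ℝ → Fin (n + 1) → ℂ) (y : Fin (n + 1) → ℂ) (θ : ℝ) :
    Fin (n + 1) → ℂ :=
  P.dHit ν y • P.dtFlow θ + S.dFlow ν y θ

/-- `L` is the operator `[ν, z] ↦ (L[ν, DR z], E L[ν, DR z](0))` on `𝔹 × ℂ^{N-1}`.  The value at `0`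
is the limit from the left. -/
def PeriodicSolution.IsLPi (L : (S.BSpace × (Fin n → ℂ)) →L[ℂ] (S.BSpace × (Fin n → ℂ))) : Prop :=
  ∀ (ν : S.BSpace) (z : Fin n → ℂ),
    (L (ν, z)).1.toLp =ᵐ[volIoo (-2 * S.T) 0] P.linFun ν.toLp (S.DR z) ∧
    ∃ w : Fin (n + 1) → ℂ, Tendsto (P.linFun ν.toLp (S.DR z)) (𝓝[<] 0) (𝓝 w) ∧
      (L (ν, z)).2 = projR w

end Linearization

/-! ### The finite-dimensional part, the Volterra part, and the operator pencil -/

section Volterra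

variable (S : System n)

/-- The Volterra operator `(V ν)(θ) = ∫_{-T}^θ e^{B(ξ-θ)} A ν(ξ) dξ`, on functions. -/
def System.volFun (ν : ℝ → Fin (n + 1) → ℂ) (θ : ℝ) : Fin (n + 1) → ℂ :=
  ∫ ξ in (-S.T)..θ, (S.expB (ξ - θ)).mulVec (S.AC.mulVec (ν ξ))

theorem System.continuous_expB : Continuous S.expB := by
  open scoped Matrix.Norms.Operator in
  exact NormedSpace.exp_continuous.comp (continuous_id.smul continuous_const)

theorem System.expB_add (a b : ℝ) : S.expB (a + b) = S.expB a * S.expB b := by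
  rw [System.expB, add_smul]
  exact Matrix.exp_add_of_commute _ _
    (((Commute.refl (S.B.map Complex.ofReal)).smul_left a).smul_right b)

theorem System.intervalIntegrable_kernel {ν : ℝ → Fin (n + 1) → ℂ}
    (hν : MemLp ν S.q (volIoo (-S.T) 0)) {a b : ℝ} (ha : a ∈ Icc (-S.T) 0) (hb : b ∈ Icc (-S.T) 0)
    (θ : ℝ) :
    IntervalIntegrable (fun ξ => (S.expB (ξ - θ)).mulVec (S.AC.mulVec (ν ξ))) volume a b := by
  have h1 : IntegrableOn ν (Icc (-S.T) 0) := by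
    rw [integrableOn_Icc_iff_integrableOn_Ioo]
    exact hν.integrable S.fact_one_le_q.out
  have h2 : IntervalIntegrable ν volume a b := by
    rw [intervalIntegrable_iff]
    exact h1.mono_set (uIoc_subset_uIcc.trans (uIcc_subset_Icc ha hb))
  have h3 : ∀ i j, IntervalIntegrable (fun ξ => (S.expB (ξ - θ) * S.AC) i j * ν ξ j) volume a b := by
    intro i j
    have hj : IntervalIntegrable (fun ξ => ν ξ j) volume a b :=
      ⟨(ContinuousLinearMap.proj (R := ℝ) (φ := fun _ : Fin (n + 1) => ℂ) j).integrable_comp h2.1,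
        (ContinuousLinearMap.proj (R := ℝ) (φ := fun _ : Fin (n + 1) => ℂ) j).integrable_comp h2.2⟩
    refine hj.continuousOn_mul (Continuous.continuousOn ?_)
    have hc : Continuous fun ξ => S.expB (ξ - θ) * S.AC :=
      (S.continuous_expB.comp (continuous_id.sub continuous_const)).matrix_mul continuous_const
    exact hc.matrix_elem i j
  have h4 : (fun ξ => (S.expB (ξ - θ)).mulVec (S.AC.mulVec (ν ξ)))
      = fun ξ i => ∑ j, (S.expB (ξ - θ) * S.AC) i j * ν ξ j := by
    funext ξ i
    rw [Matrix.mulVec_mulVec]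
    rfl
  rw [h4, intervalIntegrable_iff]
  refine Integrable.of_eval fun i => integrable_finsetSum _ fun j _ => ?_
  exact (intervalIntegrable_iff.1 (h3 i j))

theorem System.volFun_eq {ν : ℝ → Fin (n + 1) → ℂ} (hν : MemLp ν S.q (volIoo (-S.T) 0))
    {θ : ℝ} (hθ : θ ∈ Icc (-S.T) 0) :
    S.volFun ν θ = (S.expB (-θ)).mulVec
      (∫ ξ in (-S.T)..θ, (S.expB ξ).mulVec (S.AC.mulVec (ν ξ))) := by
  have h := S.intervalIntegrable_kernel hν (left_mem_Icc.2 (by linarith [S.T_pos])) hθ 0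
  simp only [sub_zero] at h
  have := (LinearMap.toContinuousLinearMap
    ((S.expB (-θ)).mulVecLin)).intervalIntegral_comp_comm h
  simp only [LinearMap.coe_toContinuousLinearMap', Matrix.mulVecLin_apply] at this
  rw [← this, System.volFun]
  refine intervalIntegral.integral_congr fun ξ _ => ?_
  simp only [Matrix.mulVec_mulVec, ← mul_assoc]
  rw [← S.expB_add, neg_add_eq_sub]

theorem System.memLp_volFun {ν : ℝ → Fin (n + 1) → ℂ} (hν : MemLp ν S.q (volIoo (-S.T) 0)) :
    MemLp (S.volFun ν) S.q (volIoo (-S.T) 0) := by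
  have hc : ContinuousOn (S.volFun ν) (Icc (-S.T) 0) := by
    have h0 : ContinuousOn (fun θ => (S.expB (-θ)).mulVec
        (∫ ξ in (-S.T)..θ, (S.expB ξ).mulVec (S.AC.mulVec (ν ξ)))) (Icc (-S.T) 0) := by
      have hle : -S.T ≤ 0 := by linarith [S.T_pos]
      have h := S.intervalIntegrable_kernel hν (left_mem_Icc.2 hle) (right_mem_Icc.2 hle) 0
      simp only [sub_zero] at h
      have hi := intervalIntegral.continuousOn_primitive_interval' h (left_mem_uIcc)
      rw [uIcc_of_le hle] at hi
      have he : ContinuousOn (fun θ => S.expB (-θ)) (Icc (-S.T) 0) :=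
        (S.continuous_expB.comp continuous_neg).continuousOn
      rw [continuousOn_iff_continuous_domRestrict] at hi he ⊢
      exact he.matrix_mulVec hi
    exact h0.congr fun θ hθ => S.volFun_eq hν hθ
  obtain ⟨C, hC⟩ := isCompact_Icc.exists_bound_of_continuousOn hc
  refine MemLp.of_bound ((hc.mono Ioo_subset_Icc_self).aestronglyMeasurable measurableSet_Ioo) C ?_
  exact (ae_restrict_iff' measurableSet_Ioo).2 (ae_of_all _ fun t ht => hC t (Ioo_subset_Icc_self ht))

theorem System.volFun_congr {ν ν' : ℝ → Fin (n + 1) → ℂ} (h : ν =ᵐ[volIoo (-S.T) 0] ν')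
    {θ : ℝ} (hθ : θ ∈ Icc (-S.T) 0) : S.volFun ν θ = S.volFun ν' θ := by
  have h1 : ∀ᵐ ξ ∂volume.restrict (Ioc (-S.T) θ), ν ξ = ν' ξ := by
    rw [← restrict_Ioo_eq_restrict_Ioc]
    exact ae_mono (Measure.restrict_mono (Ioo_subset_Ioo_right hθ.2) le_rfl) h
  refine intervalIntegral.integral_congr_ae_restrict ?_
  rw [uIoc_of_le hθ.1]
  filter_upwards [h1] with ξ hξ
  rw [hξ]

theorem System.volFun_add {ν ν' : ℝ → Fin (n + 1) → ℂ} (hν : MemLp ν S.q (volIoo (-S.T) 0))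
    (hν' : MemLp ν' S.q (volIoo (-S.T) 0)) {θ : ℝ} (hθ : θ ∈ Icc (-S.T) 0) :
    S.volFun (ν + ν') θ = S.volFun ν θ + S.volFun ν' θ := by
  have h0 : -S.T ∈ Icc (-S.T) 0 := left_mem_Icc.2 (by linarith [S.T_pos])
  simp only [System.volFun, Pi.add_apply, Matrix.mulVec_add]
  exact intervalIntegral.integral_add (S.intervalIntegrable_kernel hν h0 hθ θ)
    (S.intervalIntegrable_kernel hν' h0 hθ θ)

theorem System.volFun_smul (c : ℂ) (ν : ℝ → Fin (n + 1) → ℂ) (θ : ℝ) :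
    S.volFun (c • ν) θ = c • S.volFun ν θ := by
  simp only [System.volFun, Pi.smul_apply, Matrix.mulVec_smul]
  exact intervalIntegral.integral_smul c _

theorem System.volFun_coe_add (ν ν' : S.LpC (-S.T) 0) {θ : ℝ} (hθ : θ ∈ Icc (-S.T) 0) :
    S.volFun (ν + ν' : S.LpC (-S.T) 0) θ = S.volFun ν θ + S.volFun ν' θ := by
  rw [S.volFun_congr (Lp.coeFn_add ν ν') hθ, S.volFun_add (Lp.memLp ν) (Lp.memLp ν') hθ]

theorem System.volFun_coe_smul (c : ℂ) (ν : S.LpC (-S.T) 0) {θ : ℝ} (hθ : θ ∈ Icc (-S.T) 0) :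
    S.volFun (c • ν : S.LpC (-S.T) 0) θ = c • S.volFun ν θ := by
  rw [S.volFun_congr (Lp.coeFn_smul c ν) hθ, S.volFun_smul]

theorem System.ae_of_Icc {P : ℝ → Prop} (h : ∀ t ∈ Icc (-S.T) 0, P t) :
    ∀ᵐ t ∂volIoo (-S.T) 0, P t :=
  (ae_restrict_iff' measurableSet_Ioo).2 (ae_of_all _ fun t ht => h t (Ioo_subset_Icc_self ht))

/-- The Volterra operator `V` on `L_p(-T, 0)`. -/
def System.vol : S.LpC (-S.T) 0 →ₗ[ℂ] S.LpC (-S.T) 0 where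
  toFun ν := (S.memLp_volFun (Lp.memLp ν)).toLp (S.volFun ν)
  map_add' ν ν' := by
    rw [← MemLp.toLp_add]
    exact MemLp.toLp_congr _ _ (S.ae_of_Icc fun t ht => S.volFun_coe_add ν ν' ht)
  map_smul' c ν := by
    rw [RingHom.id_apply, ← MemLp.toLp_const_smul]
    exact MemLp.toLp_congr _ _ (S.ae_of_Icc fun t ht => S.volFun_coe_smul c ν ht)

/-- The value `(V ν)(0)`. -/
def System.volZero : S.LpC (-S.T) 0 →ₗ[ℂ] (Fin (n + 1) → ℂ) where
  toFun ν := S.volFun ν 0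
  map_add' ν ν' := S.volFun_coe_add ν ν' (right_mem_Icc.2 (by linarith [S.T_pos]))
  map_smul' c ν := S.volFun_coe_smul c ν (right_mem_Icc.2 (by linarith [S.T_pos]))

/-- The space `L_p(-T, 0) × L_p(-T, 0) × ℂ^{N-1}`. -/
abbrev System.YSpace : Type := S.LpC (-S.T) 0 × S.LpC (-S.T) 0 × (Fin n → ℂ)

/-- The operator `𝓥 (ν₁, ν₂, z) = (ν₂, V ν₁, 0)`. -/
def System.calV : Module.End ℂ S.YSpace where
  toFun w := (w.2.1, S.vol w.1, 0)
  map_add' w w' := by simp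
  map_smul' c w := by simp

/-- `M` on complex vectors, as a linear map. -/
def System.MLin : (Fin (n + 1) → ℂ) →ₗ[ℂ] ℂ where
  toFun := S.MC
  map_add' x y := by simp [System.MC, mul_add, Finset.sum_add_distrib]
  map_smul' c x := by
    simp only [System.MC, Pi.smul_apply, smul_eq_mul, RingHom.id_apply, Finset.mul_sum]
    exact Finset.sum_congr rfl fun j _ => by ring

/-- `DR` as a linear map. -/
def System.DRLin : (Fin n → ℂ) →ₗ[ℂ] (Fin (n + 1) → ℂ) where
  toFun := S.DR
  map_add' x y := by
    funext i
    refine Fin.cases ?_ (fun j => ?_) i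
    · simp [System.DR, mul_add, Finset.sum_add_distrib]
    · simp [System.DR]
  map_smul' c x := by
    funext i
    refine Fin.cases ?_ (fun j => ?_) i
    · simp only [System.DR, Fin.cons_zero, Pi.smul_apply, smul_eq_mul, RingHom.id_apply,
        Finset.mul_sum]
      exact Finset.sum_congr rfl fun j _ => by ring
    · simp [System.DR]

/-- `projR` as a linear map. -/
def projRLin : (Fin (n + 1) → ℂ) →ₗ[ℂ] (Fin n → ℂ) where
  toFun := projR
  map_add' _ _ := rfl
  map_smul' _ _ := rfl

end Volterra

section FinitePart

variable {S : System n} (P : PeriodicSolution S)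

/-- The derivative of the periodic solution is in `L_p(0, 2T)`. -/
theorem PeriodicSolution.memLp_deriv_u : MemLp (deriv P.u) S.q (volIoo 0 (2 * S.T)) := by
  have hT := S.T_pos
  obtain ⟨-, ⟨g, ⟨-, hg, hu⟩, -⟩, -⟩ := P.isSolution (2 * S.T) (by linarith)
  refine (memLp_congr_ae ?_).2 hg
  have hle : (0 : ℝ) ≤ 2 * S.T := by linarith
  have hi : IntervalIntegrable g volume 0 (2 * S.T) := by
    rw [intervalIntegrable_iff, uIoc_of_le hle, ← integrableOn_Icc_iff_integrableOn_Ioc,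
      integrableOn_Icc_iff_integrableOn_Ioo]
    exact hg.integrable S.fact_one_le_q.out
  have hd := hi.ae_hasDerivAt_integral
  refine (ae_restrict_iff' measurableSet_Ioo).2 ?_
  filter_upwards [hd] with t ht htI
  have h1 := ht (by rw [uIcc_of_le hle]; exact Ioo_subset_Icc_self htI) 0 left_mem_uIcc
  have h2 : HasDerivAt P.u (g t) t := by
    refine (h1.const_add (P.u 0)).congr_of_eventuallyEq ?_
    filter_upwards [Ioo_mem_nhds htI.1 htI.2] with r hr
    exact hu r (Ioo_subset_Icc_self hr)
  exact h2.deriv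

theorem PeriodicSolution.dphi_eq (θ : ℝ) : P.dphi θ = toC (deriv P.u (2 * S.T + θ)) := by
  simp [PeriodicSolution.dphi, deriv_comp_const_add]

theorem PeriodicSolution.memLp_dphi {c : ℝ} (h0 : 0 ≤ 2 * S.T + c - S.T) (h1 : c ≤ 0) :
    MemLp (fun θ => P.dphi (θ + c)) S.q (volIoo (-S.T) 0) := by
  have hm : MemLp (deriv P.u) S.q (volIoo (-S.T + (2 * S.T + c)) (0 + (2 * S.T + c))) := by
    refine P.memLp_deriv_u.mono_measure (Measure.restrict_mono (Ioo_subset_Ioo ?_ ?_) le_rfl)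
    · linarith
    · linarith
  have hp : MeasurePreserving (fun θ : ℝ => θ + (2 * S.T + c)) (volIoo (-S.T) 0)
      (volIoo (-S.T + (2 * S.T + c)) (0 + (2 * S.T + c))) := by
    have := (measurePreserving_add_right volume (2 * S.T + c)).restrict_preimage
      (measurableSet_Ioo (a := -S.T + (2 * S.T + c)) (b := 0 + (2 * S.T + c)))
    rwa [preimage_add_const_Ioo, add_sub_cancel_right, add_sub_cancel_right] at this
  have hr := hm.comp_measurePreserving hp
  have hC : MemLp (fun θ => toC (deriv P.u (θ + (2 * S.T + c)))) S.q (volIoo (-S.T) 0) := by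
    refine MemLp.of_le hr ?_ ?_
    · have : Continuous (toC : (Fin (n + 1) → ℝ) → Fin (n + 1) → ℂ) := by
        unfold toC; fun_prop
      exact this.comp_aestronglyMeasurable hr.1
    · refine ae_of_all _ fun θ => ?_
      refine (pi_norm_le_iff_of_nonneg (norm_nonneg _)).2 fun i => ?_
      simpa [toC] using norm_le_pi_norm (deriv P.u (θ + (2 * S.T + c))) i
  refine (memLp_congr_ae (ae_of_all _ fun θ => ?_)).1 hC
  rw [P.dphi_eq]
  congr 2
  ring

/-- The function `θ ↦ φ_α'(θ)` in `L_p(-T, 0)`. -/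
def PeriodicSolution.dphi₁ : S.LpC (-S.T) 0 :=
  (P.memLp_dphi (c := 0) (by linarith [S.T_pos]) le_rfl).toLp _

/-- The function `θ ↦ φ_α'(θ - T)` in `L_p(-T, 0)`. -/
def PeriodicSolution.dphi₂ : S.LpC (-S.T) 0 :=
  (P.memLp_dphi (c := -S.T) (by linarith) (by linarith [S.T_pos])).toLp _

theorem System.memLp_expDR (S : System n) (z : Fin n → ℂ) :
    MemLp (fun θ => (S.expB (-(θ + S.T))).mulVec (S.DRLin z)) S.q (volIoo (-S.T) 0) := by
  have hc : Continuous fun θ => (S.expB (-(θ + S.T))).mulVec (S.DRLin z) :=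
    (S.continuous_expB.comp (by fun_prop)).matrix_mulVec continuous_const
  obtain ⟨C, hC⟩ := (isCompact_Icc (a := -S.T) (b := 0)).exists_bound_of_continuousOn hc.continuousOn
  exact MemLp.of_bound hc.aestronglyMeasurable C (S.ae_of_Icc hC)

/-- The operator `z ↦ e^{-B(θ+T)} DR z` into `L_p(-T, 0)`. -/
def System.expDR (S : System n) : (Fin n → ℂ) →ₗ[ℂ] S.LpC (-S.T) 0 where
  toFun z := (S.memLp_expDR z).toLp _
  map_add' z z' := by
    rw [← MemLp.toLp_add]
    refine MemLp.toLp_congr _ _ (ae_of_all _ fun t => ?_)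
    simp [Matrix.mulVec_add]
  map_smul' c z := by
    rw [RingHom.id_apply, ← MemLp.toLp_const_smul]
    refine MemLp.toLp_congr _ _ (ae_of_all _ fun t => ?_)
    simp [Matrix.mulVec_smul]

/-- The functional `c₁[ν₁] = -M[∫_{-T}^0 e^{Bξ} A ν₁(ξ) dξ] / M[φ_α'(-T-)]`. -/
def PeriodicSolution.c₁ : S.LpC (-S.T) 0 →ₗ[ℂ] ℂ :=
  (-(S.MC P.dphiLeft)⁻¹) • (S.MLin ∘ₗ S.volZero)

/-- The functional `c₂[z] = -M[e^{-BT} DR z] / M[φ_α'(-T-)]`. -/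
def PeriodicSolution.c₂ : (Fin n → ℂ) →ₗ[ℂ] ℂ :=
  (-(S.MC P.dphiLeft)⁻¹) • (S.MLin ∘ₗ (S.expB (-S.T)).mulVecLin ∘ₗ S.DRLin)

/-- The functional `(ν₁, ν₂, z) ↦ c₁[ν₁] + c₂[z]`. -/
def PeriodicSolution.cSum : S.YSpace →ₗ[ℂ] ℂ :=
  P.c₁ ∘ₗ LinearMap.fst ℂ _ _ + P.c₂ ∘ₗ LinearMap.snd ℂ _ _ ∘ₗ LinearMap.snd ℂ _ _

/-- The finite-dimensional operator `𝓕`.  With `c = c₁[ν₁] + c₂[z]`, it maps `(ν₁, ν₂, z)` to the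
triple with components `c φ_α'(θ)`, `c φ_α'(θ - T) + e^{-B(θ+T)} DR z` and
`E [(V ν₁)(0) + c φ_α'(-T-) + e^{-BT} DR z]`. -/
def PeriodicSolution.calF : Module.End ℂ S.YSpace :=
  let z : S.YSpace →ₗ[ℂ] (Fin n → ℂ) := LinearMap.snd ℂ _ _ ∘ₗ LinearMap.snd ℂ _ _
  (P.cSum.smulRight P.dphi₁).prod
    ((P.cSum.smulRight P.dphi₂ + S.expDR ∘ₗ z).prod
      (projRLin ∘ₗ (S.volZero ∘ₗ LinearMap.fst ℂ _ _ + P.cSum.smulRight P.dphiLeft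
        + (S.expB (-S.T)).mulVecLin ∘ₗ S.DRLin ∘ₗ z)))

/-- The operator pencil `𝓜(μ) = I - 𝓕 (μ I - 𝓥)⁻¹` on the range of `𝓕`. -/
def PeriodicSolution.pencil (μ : ℂ) : Module.End ℂ (LinearMap.range P.calF) :=
  LinearMap.id - P.calF.rangeRestrict ∘ₗ
    (Ring.inverse (algebraMap ℂ (Module.End ℂ S.YSpace) μ - S.calV)) ∘ₗ
      (LinearMap.range P.calF).subtype

end FinitePart

end HystDelay

end

/-!
Cutting functions on `(-2T, 0)` at `-T` embeds `𝔹 × ℂ^{N-1}` into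
`Y = L_p(-T, 0) × L_p(-T, 0) × ℂ^{N-1}`, and there the formal linearization is the restriction of
`𝓥 + 𝓕` (`PeriodicSolution.isLPi_iff`), a bounded operator.  The theorem compares this operator
with its restriction.

The image of `𝔹 × ℂ^{N-1}` consists of the triples whose second component is of class `W_p^s` on
`(-T, 0)` and whose first component is of class `W_p^s` on `(-σ, 0)`; no condition couples the two
components at the cut, because for `s p < 1` functions of class `W_p^s` on adjacent intervals glue
(`MemWsp.glue`).  This rests on the fractional Hardy inequality (`lintegral_hardy_lt_top`).  The
operator `𝓥 + 𝓕` preserves the image, and its square maps all of `Y` into it: the second component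
of a value is always of class `W_p^s`, since the Volterra operator smooths (`System.memWsp_volFun`)
and the periodic solution is a classical solution of an ordinary differential equation between
switching times (`PeriodicSolution.memWsp_dphi`), and a second application carries this regularity
over to the first component.  As `𝔹` is complete, the restriction is bounded by the closed graph
theorem.

Let `μ ≠ 0`.  The Volterra operator is quasi-nilpotent, so `μ I - 𝓥` is invertible
(`System.isUnit_sub_calV`).  If `(𝓥 + 𝓕) w = μ w`, then `μ² w = (𝓥 + 𝓕)² w` lies in the image of
`𝔹 × ℂ^{N-1}`, and similarly for solutions of `μ w - (𝓥 + 𝓕) w = f` with `f` in the image.  So a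
nonzero element of the kernel of the pencil gives an eigenvector of the linearization.  If the
kernel is trivial, then the pencil, which acts on a finite-dimensional space, is bijective, hence so
is `μ I - 𝓥 - 𝓕` (`bijective_sub_of_ker_pencil_eq_bot`), hence so is its restriction, whose inverse
is bounded by the open mapping theorem.
-/

noncomputable section

namespace HystDelay

/-! ### Singular kernels and fractional Sobolev spaces on intervals -/

section Kernel

theorem enorm_rpow_neg_eq {x : ℝ} (hx : x ≠ 0) (γ : ℝ) :
    ‖x‖ₑ ^ γ = ENNReal.ofReal (|x| ^ γ) := by
  rw [← ENNReal.ofReal_rpow_of_pos (abs_pos.2 hx), Real.enorm_eq_ofReal_abs]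

theorem lintegral_kernel_lt_top {γ : ℝ} (hγ : γ < 1) (L : ℝ) :
    ∫⁻ x in Ioo (-L) L, ‖x‖ₑ ^ (-γ) < ⊤ := by
  have h : IntervalIntegrable (fun x : ℝ => (x : ℂ) ^ ((-γ : ℝ) : ℂ)) volume (-L) L :=
    intervalIntegral.intervalIntegrable_cpow' (by simpa using hγ)
  have h2 := (h.1.mono_set Ioo_subset_Ioc_self).2
  refine lt_of_eq_of_lt ?_ h2
  refine lintegral_congr_ae ?_
  have : ∀ᵐ x : ℝ ∂volume.restrict (Ioo (-L) L), x ≠ 0 :=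
    ae_restrict_of_ae (by simp [ae_iff])
  filter_upwards [this] with x hx
  rw [enorm_rpow_neg_eq hx, ← ofReal_norm, Complex.norm_cpow_real]
  simp

theorem exists_lintegral_kernel_le {γ : ℝ} (hγ : γ < 1) (a b : ℝ) :
    ∃ C < (⊤ : ℝ≥0∞), ∀ r ∈ Ioo a b, ∫⁻ t in Ioo a b, ‖t - r‖ₑ ^ (-γ) ≤ C := by
  refine ⟨_, lintegral_kernel_lt_top hγ (b - a), fun r hr => ?_⟩
  have hp := (measurePreserving_sub_right (volume : Measure ℝ) r).setLIntegral_comp_preimage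
    (measurableSet_Ioo (a := -(b - a)) (b := b - a))
    (f := fun x : ℝ => ‖x‖ₑ ^ (-γ)) (by fun_prop)
  rw [← hp]
  refine lintegral_mono_set fun t ht => ?_
  simp only [mem_preimage, mem_Ioo] at *
  constructor <;> linarith

theorem lintegral_Ioi_kernel {γ d : ℝ} (hγ : 0 < γ) (hd : 0 < d) :
    ∫⁻ x in Ioi d, ‖x‖ₑ ^ (-(1 + γ)) = ENNReal.ofReal (1 / γ) * ‖d‖ₑ ^ (-γ) := by
  have hi := integrableOn_Ioi_rpow_of_lt (a := -(1 + γ)) (by linarith) hd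
  have he := integral_Ioi_rpow_of_lt (a := -(1 + γ)) (by linarith) hd
  have hz : ∀ x ∈ Ioi d, ‖x‖ₑ ^ (-(1 + γ)) = ENNReal.ofReal (x ^ (-(1 + γ))) := fun x hx => by
    have hx : 0 < x := hd.trans hx
    rw [enorm_rpow_neg_eq hx.ne', abs_of_pos hx]
  rw [setLIntegral_congr_fun measurableSet_Ioi hz, ← ofReal_integral_eq_lintegral_ofReal hi, he,
    enorm_rpow_neg_eq hd.ne', abs_of_pos hd, ← ENNReal.ofReal_mul (by positivity)]
  · congr 1
    rw [show -(1 + γ) + 1 = -γ by ring]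
    field_simp
  · refine (ae_restrict_iff' measurableSet_Ioi).2 (ae_of_all _ fun x hx => ?_)
    exact Real.rpow_nonneg (hd.trans hx).le _

theorem lintegral_far_kernel {γ : ℝ} (hγ : 0 < γ) {t c : ℝ} {s : Set ℝ}
    (hs : s ⊆ Ioi c ∧ t < c ∨ s ⊆ Iio c ∧ c < t) :
    ∫⁻ ξ in s, ‖t - ξ‖ₑ ^ (-(1 + γ)) ≤ ENNReal.ofReal (1 / γ) * ‖t - c‖ₑ ^ (-γ) := by
  rcases hs with ⟨hs, h⟩ | ⟨hs, h⟩
  · rw [← enorm_neg (t - c), neg_sub, ← lintegral_Ioi_kernel hγ (sub_pos.2 h)]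
    have hp := (measurePreserving_sub_right (volume : Measure ℝ) t).setLIntegral_comp_preimage
      (measurableSet_Ioi (a := c - t)) (f := fun x : ℝ => ‖x‖ₑ ^ (-(1 + γ))) (by fun_prop)
    rw [← hp]
    refine (lintegral_mono_set (t := (fun x => x - t) ⁻¹' Ioi (c - t)) fun ξ hξ => ?_).trans ?_
    · simpa using hs hξ
    · refine lintegral_mono fun ξ => ?_
      rw [← enorm_neg (t - ξ), neg_sub]
  · rw [← lintegral_Ioi_kernel hγ (sub_pos.2 h)]
    have hp := ((volume : Measure ℝ).measurePreserving_sub_left t).setLIntegral_comp_preimage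
      (measurableSet_Ioi (a := t - c)) (f := fun x : ℝ => ‖x‖ₑ ^ (-(1 + γ))) (by fun_prop)
    rw [← hp]
    refine lintegral_mono_set fun ξ hξ => ?_
    have : ξ < c := hs hξ
    simpa using this

/-- The change of variables `ξ = r t` in a Lebesgue integral over an interval. -/
theorem lintegral_Ioo_comp_mul {r : ℝ} (hr : 0 < r) (a b : ℝ) {F : ℝ → ℝ≥0∞} (hF : Measurable F) :
    ∫⁻ t in Ioo a b, F (r * t) = (ENNReal.ofReal r)⁻¹ * ∫⁻ ξ in Ioo (r * a) (r * b), F ξ := by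
  have h1 : ∫⁻ t in Ioo a b, F (r * t) = ∫⁻ t, (Ioo (r * a) (r * b)).indicator F (r * t) := by
    rw [← lintegral_indicator measurableSet_Ioo]
    refine lintegral_congr fun t => ?_
    by_cases ht : t ∈ Ioo a b
    · rw [indicator_of_mem ht, indicator_of_mem]
      exact ⟨by gcongr; exact ht.1, by gcongr; exact ht.2⟩
    · rw [indicator_of_notMem ht, indicator_of_notMem]
      exact fun h => ht ⟨lt_of_mul_lt_mul_left h.1 hr.le, lt_of_mul_lt_mul_left h.2 hr.le⟩
  rw [h1, ← lintegral_map (hF.indicator measurableSet_Ioo) (measurable_const_mul r),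
    Real.map_volume_mul_left hr.ne', lintegral_smul_measure, lintegral_indicator measurableSet_Ioo,
    abs_of_pos (inv_pos.2 hr), ENNReal.ofReal_inv_of_pos hr, smul_eq_mul]

end Kernel

section Seminorm

variable {E : Type*} [NormedAddCommGroup E]

/-- The integrand `|f(t) - f(ξ)| ^ p / |t - ξ| ^ (1 + s p)` of the Sobolev-Slobodeckij seminorm.
On the diagonal the numerator vanishes, and `⊤ * 0 = 0`. -/
def slobIntegrand (p s : ℝ) (f : ℝ → E) (t ξ : ℝ) : ℝ≥0∞ :=
  ‖t - ξ‖ₑ ^ (-(1 + s * p)) * ‖f t - f ξ‖ₑ ^ p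

theorem enorm_slobQuot_rpow [NormedSpace ℝ E] {p s : ℝ} (hp : 0 < p) (f : ℝ → E) (z : ℝ × ℝ) :
    ‖slobQuot p s f z‖ₑ ^ p = slobIntegrand p s f z.1 z.2 := by
  rcases eq_or_ne z.1 z.2 with h | h
  · simp [slobQuot, slobIntegrand, h, hp]
  · have hx := sub_ne_zero.2 h
    rw [slobQuot, slobIntegrand, enorm_smul, ENNReal.mul_rpow_of_nonneg _ _ hp.le,
      Real.enorm_eq_ofReal (by positivity), ← enorm_rpow_neg_eq hx, ← ENNReal.rpow_mul]
    congr 2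
    field_simp

theorem slobIntegrand_comm (p s : ℝ) (f : ℝ → E) (t ξ : ℝ) :
    slobIntegrand p s f t ξ = slobIntegrand p s f ξ t := by
  rw [slobIntegrand, slobIntegrand, ← enorm_neg (t - ξ), neg_sub, ← enorm_neg (f t - f ξ), neg_sub]

theorem measurable_slobIntegrand (p s : ℝ) {f : ℝ → E} (hf : StronglyMeasurable f) :
    Measurable fun z : ℝ × ℝ => slobIntegrand p s f z.1 z.2 := by
  have h1 : StronglyMeasurable fun z : ℝ × ℝ => f z.1 - f z.2 :=
    (hf.comp_measurable measurable_fst).sub (hf.comp_measurable measurable_snd)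
  have h2 := h1.enorm.pow_const p
  exact Measurable.mul (by fun_prop) h2

theorem memLp_slobQuot_iff [NormedSpace ℝ E] {p s : ℝ} (hp : 1 < p) {μ : Measure ℝ} [SFinite μ]
    {f : ℝ → E} (hf : AEStronglyMeasurable f μ) :
    MemLp (slobQuot p s f) (ENNReal.ofReal p) (μ.prod μ) ↔
      ∫⁻ z, slobIntegrand p s f z.1 z.2 ∂(μ.prod μ) < ⊤ := by
  have hp0 : 0 < p := by linarith
  rw [MemLp, and_iff_right (aestronglyMeasurable_slobQuot p s hf),
    eLpNorm_lt_top_iff_lintegral_rpow_enorm_lt_top (by simpa using hp0) ENNReal.ofReal_ne_top,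
    ENNReal.toReal_ofReal hp0.le]
  simp only [enorm_slobQuot_rpow hp0]

theorem memLp_iff_lintegral_rpow_lt_top {p : ℝ} (hp : 1 < p) {μ : Measure ℝ} {f : ℝ → E}
    (hf : AEStronglyMeasurable f μ) :
    MemLp f (ENNReal.ofReal p) μ ↔ ∫⁻ t, ‖f t‖ₑ ^ p ∂μ < ⊤ := by
  have hp0 : 0 < p := by linarith
  rw [MemLp, and_iff_right hf, eLpNorm_lt_top_iff_lintegral_rpow_enorm_lt_top (by simpa using hp0)
    ENNReal.ofReal_ne_top, ENNReal.toReal_ofReal hp0.le]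

variable [NormedSpace ℝ E]

theorem MemWsp.congr {p s a b : ℝ} {f g : ℝ → E} (hf : MemWsp p s a b f)
    (h : f =ᵐ[volIoo a b] g) : MemWsp p s a b g :=
  ⟨(memLp_congr_ae h).1 hf.1, (memLp_congr_ae (slobQuot_congr p s h)).1 hf.2⟩

theorem MemWsp.add {p s a b : ℝ} {f g : ℝ → E} (hf : MemWsp p s a b f) (hg : MemWsp p s a b g) :
    MemWsp p s a b (f + g) :=
  ⟨hf.1.add hg.1, by rw [slobQuot_add]; exact hf.2.add hg.2⟩

theorem MemWsp.const_smul {p s a b : ℝ} [NormedSpace ℂ E] {f : ℝ → E} (hf : MemWsp p s a b f)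
    (c : ℂ) : MemWsp p s a b (c • f) :=
  ⟨hf.1.const_smul c, by rw [slobQuot_smul]; exact hf.2.const_smul c⟩

theorem MemWsp.mono {p s a b a' b' : ℝ} {f : ℝ → E} (hf : MemWsp p s a b f) (ha : a ≤ a')
    (hb : b' ≤ b) : MemWsp p s a' b' f := by
  have h : volIoo a' b' ≤ volIoo a b := Measure.restrict_mono (Ioo_subset_Ioo ha hb) le_rfl
  refine ⟨hf.1.mono_measure h, hf.2.mono_measure ?_⟩
  rw [Measure.prod_restrict, Measure.prod_restrict]
  exact Measure.restrict_mono (prod_mono (Ioo_subset_Ioo ha hb) (Ioo_subset_Ioo ha hb)) le_rfl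

/-- Fractional Sobolev spaces on intervals are invariant under isometries of the line. -/
theorem MemWsp.comp_isometry {p s a b a' b' : ℝ} {f : ℝ → E} (hf : MemWsp p s a b f)
    {τ : ℝ → ℝ} (hτ : MeasurePreserving τ (volIoo a' b') (volIoo a b)) (hi : Isometry τ) :
    MemWsp p s a' b' (f ∘ τ) := by
  refine ⟨hf.1.comp_measurePreserving hτ, ?_⟩
  have : slobQuot p s (f ∘ τ) = slobQuot p s f ∘ Prod.map τ τ := by
    funext z
    have := hi.dist_eq z.1 z.2
    rw [Real.dist_eq, Real.dist_eq] at this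
    simp [slobQuot, this]
  rw [this]
  exact hf.2.comp_measurePreserving (hτ.prod hτ)

theorem measurePreserving_add_volIoo {a b a' b' : ℝ} (c : ℝ) (ha : a' + c = a) (hb : b' + c = b) :
    MeasurePreserving (fun θ : ℝ => θ + c) (volIoo a' b') (volIoo a b) := by
  have := (measurePreserving_add_right volume c).restrict_preimage
    (measurableSet_Ioo (a := a) (b := b))
  rwa [preimage_add_const_Ioo, ← ha, ← hb, add_sub_cancel_right, add_sub_cancel_right,
    ha, hb] at this

theorem measurePreserving_sub_volIoo {a b a' b' : ℝ} (c : ℝ) (ha : c - a' = b) (hb : c - b' = a) :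
    MeasurePreserving (fun θ : ℝ => c - θ) (volIoo a' b') (volIoo a b) := by
  have := ((volume : Measure ℝ).measurePreserving_sub_left c).restrict_preimage
    (measurableSet_Ioo (a := a) (b := b))
  rwa [preimage_const_sub_Ioo, ← ha, ← hb, sub_sub_cancel, sub_sub_cancel, ha, hb] at this

theorem MemWsp.comp_add_right {p s a b a' b' : ℝ} {f : ℝ → E} (hf : MemWsp p s a b f) (c : ℝ)
    (ha : a' + c = a) (hb : b' + c = b) : MemWsp p s a' b' (fun θ => f (θ + c)) :=
  hf.comp_isometry (measurePreserving_add_volIoo c ha hb) (isometry_add_right c)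

theorem MemWsp.comp_sub_left {p s a b a' b' : ℝ} {f : ℝ → E} (hf : MemWsp p s a b f) (c : ℝ)
    (ha : c - a' = b) (hb : c - b' = a) : MemWsp p s a' b' (fun θ => f (c - θ)) :=
  hf.comp_isometry (measurePreserving_sub_volIoo c ha hb)
    (Isometry.of_dist_eq fun x y => by rw [dist_sub_left])

end Seminorm

/-! ### Upper gradients, and averaging over dilations -/

theorem rpow_le_rpow_of_nonpos {x y : ℝ≥0∞} {z : ℝ} (hz : z ≤ 0) (h : x ≤ y) :
    y ^ z ≤ x ^ z := by
  rw [← neg_neg z, ENNReal.rpow_neg y, ENNReal.rpow_neg x]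
  exact ENNReal.inv_le_inv.2 (ENNReal.rpow_le_rpow h (neg_nonneg.2 hz))

section Gradient

variable {E : Type*} [NormedAddCommGroup E]

/-- Hölder's inequality against the constant function `1`. -/
theorem lintegral_rpow_le_measure_mul {p : ℝ} (hp : 1 < p) {X : Type*} [MeasurableSpace X]
    {μ : Measure X} {G : X → ℝ≥0∞} (hG : AEMeasurable G μ) :
    (∫⁻ r, G r ∂μ) ^ p ≤ μ univ ^ (p - 1) * ∫⁻ r, G r ^ p ∂μ := by
  have hpq : p.HolderConjugate (p / (p - 1)) := Real.HolderConjugate.conjExponent hp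
  have h := ENNReal.lintegral_mul_le_Lp_mul_Lq μ hpq hG (aemeasurable_const (b := (1 : ℝ≥0∞)))
  simp only [Pi.mul_apply, mul_one, ENNReal.one_rpow, lintegral_const, one_mul] at h
  refine (ENNReal.rpow_le_rpow h (by linarith)).trans_eq ?_
  have hp1 : p - 1 ≠ 0 := by linarith
  rw [ENNReal.mul_rpow_of_nonneg _ _ (by linarith), ← ENNReal.rpow_mul, ← ENNReal.rpow_mul,
    one_div_mul_cancel (by linarith), ENNReal.rpow_one, mul_comm]
  congr 2
  field_simp

/-- If `G ∈ L_p` bounds the increments of `f` by its integrals, then the Slobodeckij integrand of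
`f` is bounded by a double convolution of `G ^ p` with a locally integrable kernel: both
`|t - r|` and `|r - ξ|` are at most `|t - ξ|` when `r` is between `t` and `ξ`. -/
theorem slobIntegrand_le_convolution {p s a b : ℝ} (hp : 1 < p) (hps : p * (1 - s) < 1)
    {f : ℝ → E} {G : ℝ → ℝ≥0∞} (hG : Measurable G) {t ξ : ℝ} (ht : t ∈ Ioo a b) (hξ : ξ ∈ Ioo a b)
    (h : ‖f t - f ξ‖ₑ ≤ ∫⁻ r in uIoc ξ t, G r) :
    slobIntegrand p s f t ξ ≤ ∫⁻ r in Ioo a b,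
      ‖t - r‖ₑ ^ (-((2 - p * (1 - s)) / 2)) *
        (‖ξ - r‖ₑ ^ (-((2 - p * (1 - s)) / 2)) * G r ^ p) := by
  have hp0 : 0 < p := by linarith
  rcases eq_or_ne t ξ with rfl | hne
  · simp [slobIntegrand, hp0]
  have hx : ‖t - ξ‖ₑ ≠ 0 := by simpa [sub_eq_zero] using hne
  have hvol : volume (uIoc ξ t) = ‖t - ξ‖ₑ := by
    rw [Real.volume_uIoc, Real.enorm_eq_ofReal_abs]
  set e := -((2 - p * (1 - s)) / 2) with he
  have he0 : e ≤ 0 := by rw [he]; linarith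
  have h1 : ‖f t - f ξ‖ₑ ^ p ≤ ‖t - ξ‖ₑ ^ (p - 1) * ∫⁻ r in uIoc ξ t, G r ^ p := by
    refine (ENNReal.rpow_le_rpow h hp0.le).trans ?_
    refine (lintegral_rpow_le_measure_mul hp hG.aemeasurable).trans_eq ?_
    rw [Measure.restrict_apply_univ, hvol]
  have hsub : uIoc ξ t ⊆ Ioo a b := uIoc_subset_uIcc.trans (ordConnected_Ioo.uIcc_subset hξ ht)
  calc slobIntegrand p s f t ξ
      ≤ ‖t - ξ‖ₑ ^ (-(1 + s * p)) * (‖t - ξ‖ₑ ^ (p - 1) * ∫⁻ r in uIoc ξ t, G r ^ p) := by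
        unfold slobIntegrand; gcongr
    _ = ∫⁻ r in uIoc ξ t, ‖t - ξ‖ₑ ^ e * (‖t - ξ‖ₑ ^ e * G r ^ p) := by
        simp_rw [← mul_assoc]
        rw [← ENNReal.rpow_add _ _ hx enorm_ne_top, ← ENNReal.rpow_add _ _ hx enorm_ne_top,
          lintegral_const_mul _ (hG.pow_const p)]
        congr 2
        rw [he]; ring
    _ ≤ ∫⁻ r in uIoc ξ t, ‖t - r‖ₑ ^ e * (‖ξ - r‖ₑ ^ e * G r ^ p) := by
        refine setLIntegral_mono' measurableSet_uIoc fun r hr => ?_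
        have hr' := uIoc_subset_uIcc hr
        have h2 : ‖t - r‖ₑ ≤ ‖t - ξ‖ₑ := by
          rw [Real.enorm_eq_ofReal_abs, Real.enorm_eq_ofReal_abs]
          refine ENNReal.ofReal_le_ofReal ?_
          exact abs_sub_right_of_mem_uIcc hr'
        have h3 : ‖ξ - r‖ₑ ≤ ‖t - ξ‖ₑ := by
          rw [Real.enorm_eq_ofReal_abs, Real.enorm_eq_ofReal_abs]
          refine ENNReal.ofReal_le_ofReal ?_
          rw [abs_sub_comm ξ r]; exact abs_sub_left_of_mem_uIcc hr'
        gcongr ?_ * (?_ * _)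
        · exact rpow_le_rpow_of_nonpos he0 h2
        · exact rpow_le_rpow_of_nonpos he0 h3
    _ ≤ _ := lintegral_mono_set hsub

/-- The embedding `W_p^1 ⊆ W_p^s`, for functions whose increments are bounded by the integrals of a
function in `L_p`. -/
theorem memWsp_of_upperGradient [NormedSpace ℝ E] {p s a b : ℝ} (hp : 1 < p) (hs : s < 1)
    (hps : p * (1 - s) < 1) {f : ℝ → E} (hf : MemLp f (ENNReal.ofReal p) (volIoo a b))
    {G : ℝ → ℝ≥0∞} (hG : AEMeasurable G (volIoo a b)) (hGp : ∫⁻ r in Ioo a b, G r ^ p < ⊤)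
    (h : ∀ t ∈ Ioo a b, ∀ ξ ∈ Ioo a b, ‖f t - f ξ‖ₑ ≤ ∫⁻ r in uIoc ξ t, G r) :
    MemWsp p s a b f := by
  refine ⟨hf, (memLp_slobQuot_iff hp hf.1).2 ?_⟩
  have hmeas : AEMeasurable (fun z : ℝ × ℝ => slobIntegrand p s f z.1 z.2)
      ((volIoo a b).prod (volIoo a b)) := by
    simp only [← enorm_slobQuot_rpow (by linarith : 0 < p)]
    exact (aestronglyMeasurable_slobQuot p s hf.1).enorm.pow_const p
  obtain ⟨H, hH, hGH⟩ : ∃ H, Measurable H ∧ G =ᵐ[volIoo a b] H :=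
    ⟨_, hG.measurable_mk, hG.ae_eq_mk⟩
  have hHp : ∫⁻ r in Ioo a b, H r ^ p < ⊤ := by
    refine lt_of_eq_of_lt (lintegral_congr_ae ?_) hGp
    filter_upwards [hGH] with r hr
    rw [hr]
  have hγ : (2 - p * (1 - s)) / 2 < 1 := by
    have : 0 < p * (1 - s) := mul_pos (by linarith) (by linarith)
    linarith
  obtain ⟨C, hC, hCI⟩ := exists_lintegral_kernel_le hγ a b
  set e := -((2 - p * (1 - s)) / 2)
  rw [lintegral_prod _ hmeas]
  have hbound : ∫⁻ t in Ioo a b, ∫⁻ ξ in Ioo a b, slobIntegrand p s f t ξ ≤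
      ∫⁻ t in Ioo a b, ∫⁻ ξ in Ioo a b, ∫⁻ r in Ioo a b,
        ‖t - r‖ₑ ^ e * (‖ξ - r‖ₑ ^ e * H r ^ p) := by
    refine setLIntegral_mono' measurableSet_Ioo fun t ht => ?_
    refine setLIntegral_mono' measurableSet_Ioo fun ξ hξ => ?_
    refine slobIntegrand_le_convolution hp hps hH ht hξ ((h t ht ξ hξ).trans_eq ?_)
    refine lintegral_congr_ae (ae_mono (Measure.restrict_mono ?_ le_rfl) hGH)
    exact uIoc_subset_uIcc.trans (ordConnected_Ioo.uIcc_subset hξ ht)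
  refine hbound.trans_lt ?_
  calc ∫⁻ t in Ioo a b, ∫⁻ ξ in Ioo a b, ∫⁻ r in Ioo a b, ‖t - r‖ₑ ^ e * (‖ξ - r‖ₑ ^ e * H r ^ p)
      ≤ ∫⁻ t in Ioo a b, ∫⁻ r in Ioo a b, ‖t - r‖ₑ ^ e * (C * H r ^ p) := by
        refine lintegral_mono fun t => ?_
        rw [lintegral_lintegral_swap (by
          refine Measurable.aemeasurable ?_
          have : Measurable fun z : ℝ × ℝ => H z.2 := hH.comp measurable_snd
          unfold Function.uncurry
          fun_prop)]
        refine setLIntegral_mono' measurableSet_Ioo fun r hr => ?_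
        rw [lintegral_const_mul _ (by fun_prop), lintegral_mul_const _ (by fun_prop)]
        gcongr
        exact hCI r hr
    _ ≤ ∫⁻ r in Ioo a b, C * (C * H r ^ p) := by
        rw [lintegral_lintegral_swap (by
          refine Measurable.aemeasurable ?_
          have : Measurable fun z : ℝ × ℝ => H z.2 := hH.comp measurable_snd
          unfold Function.uncurry
          fun_prop)]
        refine setLIntegral_mono' measurableSet_Ioo fun r hr => ?_
        rw [lintegral_mul_const _ (by fun_prop)]
        gcongr
        exact hCI r hr
    _ < ⊤ := by
        rw [lintegral_const_mul _ (by fun_prop), lintegral_const_mul _ (by fun_prop)]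
        exact ENNReal.mul_lt_top hC (ENNReal.mul_lt_top hC hHp)

end Gradient

section Hardy

variable {E : Type*} [NormedAddCommGroup E]

/-- Averaging the weighted dilation difference `t ^ (-s p) |f(t) - f(r t)| ^ p` over `r ∈ (2, 3)`
gives the Slobodeckij seminorm, so some `r` makes its integral finite. -/
theorem exists_dilation_lintegral_lt_top {p s a : ℝ} (hp : 1 < p) (hs : 0 < s)
    {f : ℝ → E} (hf : StronglyMeasurable f)
    (h : ∫⁻ t in Ioo 0 a, ∫⁻ ξ in Ioo 0 a, slobIntegrand p s f t ξ < ⊤) :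
    ∃ r ∈ Ioo (2 : ℝ) 3,
      ∫⁻ t in Ioo 0 (a / 3), ‖t‖ₑ ^ (-(s * p)) * ‖f t - f (r * t)‖ₑ ^ p < ⊤ := by
  have hsp : 0 < s * p := mul_pos hs (by linarith)
  have hm1 : Measurable fun z : ℝ × ℝ => ‖f z.1 - f z.2‖ₑ :=
    ((hf.comp_measurable measurable_fst).sub (hf.comp_measurable measurable_snd)).enorm
  have hm : Measurable fun z : ℝ × ℝ =>
      ‖z.2‖ₑ ^ (-(s * p)) * ‖f z.2 - f (z.1 * z.2)‖ₑ ^ p := by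
    have : Measurable fun z : ℝ × ℝ => ‖f z.2 - f (z.1 * z.2)‖ₑ :=
      hm1.comp (f := fun z : ℝ × ℝ => (z.2, z.1 * z.2)) (by fun_prop)
    fun_prop
  have key : ∫⁻ r in Ioo (2 : ℝ) 3, ∫⁻ t in Ioo 0 (a / 3),
      ‖t‖ₑ ^ (-(s * p)) * ‖f t - f (r * t)‖ₑ ^ p < ⊤ := by
    rw [lintegral_lintegral_swap hm.aemeasurable]
    refine lt_of_le_of_lt (b := ∫⁻ t in Ioo 0 (a / 3), ENNReal.ofReal 2 ^ (1 + s * p) *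
      ∫⁻ ξ in Ioo 0 a, slobIntegrand p s f t ξ) ?_ ?_
    · refine setLIntegral_mono' measurableSet_Ioo fun t ht => ?_
      have hF : Measurable fun ξ => ‖f t - f ξ‖ₑ ^ p :=
        (hm1.comp (f := fun ξ => (t, ξ)) (by fun_prop)).pow_const p
      have hsl : Measurable fun ξ => slobIntegrand p s f t ξ :=
        (measurable_slobIntegrand p s hf).comp (f := fun ξ => (t, ξ)) (by fun_prop)
      rw [lintegral_const_mul' _ _ (ENNReal.rpow_ne_top_of_ne_zero
        (by simpa using ht.1.ne') enorm_ne_top)]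
      simp_rw [mul_comm _ t]
      rw [lintegral_Ioo_comp_mul ht.1 2 3 hF, ← mul_assoc, ← lintegral_const_mul _ hF,
        ← lintegral_const_mul _ hsl]
      refine (setLIntegral_mono' measurableSet_Ioo fun ξ hξ => ?_).trans
        (lintegral_mono_set (Ioo_subset_Ioo (by linarith [ht.1]) (by linarith [ht.2])))
      rw [slobIntegrand, ← mul_assoc]
      gcongr ?_ * _
      have ht0 : ‖t‖ₑ ≠ 0 := by simpa using ht.1.ne'
      rw [← Real.enorm_eq_ofReal ht.1.le, ← ENNReal.rpow_neg_one, ← ENNReal.rpow_add _ _ ht0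
        enorm_ne_top, show -(s * p) + -1 = -(1 + s * p) by ring]
      -- `|t - ξ| ≤ 2 t` for `ξ ∈ (2 t, 3 t)`
      have h2 : ‖t - ξ‖ₑ ≤ ENNReal.ofReal 2 * ‖t‖ₑ := by
        rw [Real.enorm_eq_ofReal_abs, Real.enorm_eq_ofReal ht.1.le, ← ENNReal.ofReal_mul (by simp)]
        refine ENNReal.ofReal_le_ofReal (abs_le.2 ⟨?_, ?_⟩) <;> linarith [hξ.1, hξ.2, ht.1]
      have h3 := rpow_le_rpow_of_nonpos (z := -(1 + s * p)) (by linarith) h2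
      rw [ENNReal.mul_rpow_of_ne_top (by simp) enorm_ne_top] at h3
      have h4 := mul_le_mul_right h3 (ENNReal.ofReal 2 ^ (1 + s * p))
      rwa [← mul_assoc, ← ENNReal.rpow_add _ _ (by simp) (by simp), add_neg_cancel,
        ENNReal.rpow_zero, one_mul] at h4
    · rw [lintegral_const_mul' _ _ (ENNReal.rpow_ne_top_of_nonneg (by linarith) (by simp))]
      refine ENNReal.mul_lt_top (ENNReal.rpow_lt_top_of_nonneg (by linarith) (by simp)) ?_
      refine (lintegral_mono_set fun t ht => ?_).trans_lt h
      exact ⟨ht.1, by linarith [ht.1, ht.2]⟩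
  have hae := ae_lt_top hm.lintegral_prod_right' key.ne
  have hne : (ae (volume.restrict (Ioo (2 : ℝ) 3))).NeBot := by
    rw [ae_neBot, Ne, Measure.restrict_eq_zero]
    norm_num
  obtain ⟨r, hr1, hr2⟩ := (hae.and (ae_restrict_mem measurableSet_Ioo)).exists
  exact ⟨r, hr2, hr1⟩

end Hardy

/-! ### The fractional Hardy inequality -/

section Hardy

variable {E : Type*} [NormedAddCommGroup E]

/-- A finite quantity that is at most `K + ρ x` with `ρ < 1` is bounded in terms of `K` and `ρ`. -/
theorem ennreal_le_div_of_le_add_mul {x K ρ : ℝ≥0∞} (hx : x ≠ ⊤) (hρ : ρ < 1)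
    (h : x ≤ K + ρ * x) : x ≤ K / (1 - ρ) := by
  have h1 : 1 - ρ ≠ 0 := (tsub_pos_of_lt hρ).ne'
  rw [ENNReal.le_div_iff_mul_le (Or.inl h1) (Or.inl (by simp)), mul_comm,
    ENNReal.sub_mul (fun _ _ => hx), one_mul]
  exact tsub_le_iff_right.2 h

/-- The fractional Hardy inequality on `(0, a)` in the range `s p < 1`.  Dilation by `r > 1` is a
strict contraction for the weighted norm `‖t ^ (-s) f(t)‖_p`, with factor `r ^ (s - 1 / p)`, and `f`
differs from its dilation by a function of finite weighted norm. -/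
theorem lintegral_hardy_lt_top {p s a : ℝ} (hp : 1 < p) (hs : 0 < s) (hsp : s * p < 1) (ha : 0 < a)
    {f : ℝ → E} (hf : StronglyMeasurable f) (hfp : ∫⁻ t in Ioo 0 a, ‖f t‖ₑ ^ p < ⊤)
    (h : ∫⁻ t in Ioo 0 a, ∫⁻ ξ in Ioo 0 a, slobIntegrand p s f t ξ < ⊤) :
    ∫⁻ t in Ioo 0 a, ‖t‖ₑ ^ (-(s * p)) * ‖f t‖ₑ ^ p < ⊤ := by
  have hp0 : 0 < p := by linarith
  have hsp0 : 0 < s * p := mul_pos hs hp0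
  obtain ⟨r, hr, hD⟩ := exists_dilation_lintegral_lt_top hp hs hf h
  have hr0 : 0 < r := by linarith [hr.1]
  set F : ℝ → ℝ≥0∞ := fun t => ‖t‖ₑ ^ (-s) * ‖f t‖ₑ with hF
  have hFm : Measurable F := Measurable.mul (by fun_prop) hf.enorm
  have hFp : ∀ t x, (‖t‖ₑ ^ (-s) * x) ^ p = ‖t‖ₑ ^ (-(s * p)) * x ^ p := fun (t : ℝ) x => by
    rw [ENNReal.mul_rpow_of_nonneg _ _ hp0.le, ← ENNReal.rpow_mul, neg_mul]
  simp_rw [← hFp]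
  -- away from zero the weight is bounded
  have hfar : ∀ ε > 0, ∫⁻ t in Ioo ε a, F t ^ p < ⊤ := fun ε hε => by
    refine lt_of_le_of_lt (b := ENNReal.ofReal ε ^ (-(s * p)) * ∫⁻ t in Ioo 0 a, ‖f t‖ₑ ^ p) ?_ ?_
    · rw [← lintegral_const_mul _ (hf.enorm.pow_const p)]
      refine (setLIntegral_mono' measurableSet_Ioo fun t ht => ?_).trans
        (lintegral_mono_set (Ioo_subset_Ioo hε.le le_rfl))
      rw [hF, hFp]
      gcongr ?_ * _
      refine rpow_le_rpow_of_nonpos (by linarith) ?_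
      rw [Real.enorm_eq_ofReal (hε.trans ht.1).le]
      exact ENNReal.ofReal_le_ofReal ht.1.le
    · refine ENNReal.mul_lt_top ?_ hfp
      exact lt_top_iff_ne_top.2 (ENNReal.rpow_ne_top_of_ne_zero (by simpa using hε) (by simp))
  set D : ℝ≥0∞ := ∫⁻ t in Ioo 0 (a / 3), ‖t‖ₑ ^ (-(s * p)) * ‖f t - f (r * t)‖ₑ ^ p
  -- `(a / 4, a)` overlaps `(0, a / 3)`, so that the two intervals cover `(0, a)`
  set Z : ℝ≥0∞ := ∫⁻ t in Ioo (a / 4) a, F t ^ p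
  have hZt : Z < ⊤ := hfar _ (by linarith)
  -- the norm of the dilation by `r` in the weighted `L_p` norm
  set ρ : ℝ≥0∞ := ENNReal.ofReal r ^ ((s * p - 1) * (1 / p))
  have hρ1 : ρ < 1 := by
    refine ENNReal.rpow_lt_one_of_one_lt_of_neg ?_ (mul_neg_of_neg_of_pos (by linarith)
      (by positivity))
    rw [ENNReal.one_lt_ofReal]; linarith [hr.1]
  set K : ℝ≥0∞ := (D ^ (1 / p) + ρ * Z ^ (1 / p)) / (1 - ρ)
  have hKt : K < ⊤ := by
    refine ENNReal.div_lt_top (ENNReal.add_ne_top.2 ⟨?_, ?_⟩) (tsub_pos_of_lt hρ1).ne'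
    · exact ENNReal.rpow_ne_top_of_nonneg (by positivity) hD.ne
    · exact ENNReal.mul_ne_top (hρ1.trans ENNReal.one_lt_top).ne
        (ENNReal.rpow_ne_top_of_nonneg (by positivity) hZt.ne)
  -- the truncation at `ε` makes the norm finite, so that it can be absorbed
  have hbound : ∀ ε ∈ Ioo 0 (a / 3), ∫⁻ t in Ioo ε (a / 3), F t ^ p ≤ K ^ p := by
    intro ε hε
    set x : ℝ≥0∞ := (∫⁻ t in Ioo ε (a / 3), F t ^ p) ^ (1 / p) with hx
    have hxp : x ^ p = ∫⁻ t in Ioo ε (a / 3), F t ^ p := by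
      rw [hx, ← ENNReal.rpow_mul, one_div_mul_cancel hp0.ne', ENNReal.rpow_one]
    have hxt : x ≠ ⊤ := by
      refine ENNReal.rpow_ne_top_of_nonneg (by positivity) (ne_of_lt ?_)
      exact (lintegral_mono_set (Ioo_subset_Ioo le_rfl (by linarith))).trans_lt (hfar ε hε.1)
    have hm1 : Measurable fun t => ‖t‖ₑ ^ (-s) * ‖f t - f (r * t)‖ₑ :=
      Measurable.mul (by fun_prop)
        (hf.sub (hf.comp_measurable (measurable_const_mul r))).enorm
    have hm2 : Measurable fun t => ENNReal.ofReal r ^ s * F (r * t) :=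
      (hFm.comp (measurable_const_mul r)).const_mul _
    have hsecond : ∫⁻ t in Ioo ε (a / 3), (ENNReal.ofReal r ^ s * F (r * t)) ^ p
        ≤ ENNReal.ofReal r ^ (s * p - 1) * (x ^ p + Z) := by
      simp_rw [ENNReal.mul_rpow_of_nonneg _ _ hp0.le, ← ENNReal.rpow_mul]
      have hFr : Measurable fun t => F (r * t) ^ p :=
        (hFm.comp (measurable_const_mul r)).pow_const p
      rw [lintegral_const_mul _ hFr]
      have := lintegral_Ioo_comp_mul hr0 ε (a / 3) (hFm.pow_const p)
      rw [this, ← mul_assoc, ← ENNReal.rpow_neg_one, ← ENNReal.rpow_add _ _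
        (by simpa using hr0) (by simp), ← sub_eq_add_neg, hxp]
      gcongr
      refine (lintegral_mono_set (t := Ioo ε (a / 3) ∪ Ioo (a / 4) a) fun t ht => ?_).trans
        (lintegral_union_le _ _ _)
      have h1 : ε < t := by nlinarith [ht.1, hr.1, hε.1]
      have h2 : t < a := by nlinarith [ht.2, hr.2]
      by_cases h3 : t < a / 3
      · exact Or.inl ⟨h1, h3⟩
      · exact Or.inr ⟨by linarith, h2⟩
    have hmink : x ≤ D ^ (1 / p) + ρ * (x + Z ^ (1 / p)) := by
      calc x ≤ (∫⁻ t in Ioo ε (a / 3), (‖t‖ₑ ^ (-s) * ‖f t - f (r * t)‖ₑ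
            + ENNReal.ofReal r ^ s * F (r * t)) ^ p) ^ (1 / p) := by
            refine ENNReal.rpow_le_rpow (setLIntegral_mono' measurableSet_Ioo fun t ht => ?_)
              (by positivity)
            refine ENNReal.rpow_le_rpow ?_ hp0.le
            have ht0 : 0 < t := hε.1.trans ht.1
            have hw : ENNReal.ofReal r ^ s * ‖r * t‖ₑ ^ (-s) = ‖t‖ₑ ^ (-s) := by
              rw [enorm_mul, ENNReal.mul_rpow_of_ne_top enorm_ne_top enorm_ne_top,
                Real.enorm_eq_ofReal hr0.le, ← mul_assoc,
                ← ENNReal.rpow_add _ _ (by simpa using hr0) (by simp), add_neg_cancel,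
                ENNReal.rpow_zero, one_mul]
            have hFr : ENNReal.ofReal r ^ s * F (r * t) = ‖t‖ₑ ^ (-s) * ‖f (r * t)‖ₑ := by
              rw [← hw, mul_assoc]
            rw [hFr, ← mul_add]
            change ‖t‖ₑ ^ (-s) * ‖f t‖ₑ ≤ _
            gcongr
            simpa using enorm_add_le (f t - f (r * t)) (f (r * t))
        _ ≤ (∫⁻ t in Ioo ε (a / 3), (‖t‖ₑ ^ (-s) * ‖f t - f (r * t)‖ₑ) ^ p) ^ (1 / p)
            + (∫⁻ t in Ioo ε (a / 3), (ENNReal.ofReal r ^ s * F (r * t)) ^ p) ^ (1 / p) :=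
            ENNReal.lintegral_Lp_add_le hm1.aemeasurable hm2.aemeasurable hp.le
        _ ≤ D ^ (1 / p) + (ENNReal.ofReal r ^ (s * p - 1) * (x ^ p + Z)) ^ (1 / p) := by
            simp_rw [hFp]
            gcongr
            exact lintegral_mono_set (Ioo_subset_Ioo_left hε.1.le)
        _ ≤ _ := by
            rw [ENNReal.mul_rpow_of_nonneg _ _ (by positivity), ← ENNReal.rpow_mul]
            gcongr
            refine (ENNReal.rpow_add_le_add_rpow _ _ (by positivity)
              ((div_le_one hp0).2 hp.le)).trans_eq ?_
            rw [← ENNReal.rpow_mul, mul_one_div_cancel hp0.ne', ENNReal.rpow_one]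
    rw [← hxp]
    refine ENNReal.rpow_le_rpow (ennreal_le_div_of_le_add_mul hxt hρ1 ?_) hp0.le
    calc x ≤ _ := hmink
      _ = _ := by ring
  have hnear : ∫⁻ t in Ioo 0 (a / 3), F t ^ p ≤ K ^ p := by
    have hU : Ioo 0 (a / 3) = ⋃ k : ℕ, Ioo (a / 3 / (k + 2 : ℝ)) (a / 3) := by
      ext t
      simp only [mem_Ioo, mem_iUnion]
      constructor
      · rintro ⟨h0, h1⟩
        obtain ⟨k, hk⟩ := exists_nat_gt (a / 3 / t)
        refine ⟨k, ?_, h1⟩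
        rw [div_lt_iff₀ (by positivity)]
        rw [div_lt_iff₀ h0] at hk
        nlinarith
      · rintro ⟨k, h0, h1⟩
        exact ⟨lt_trans (by positivity) h0, h1⟩
    have hmono : Monotone fun k : ℕ => Ioo (a / 3 / (k + 2 : ℝ)) (a / 3) := by
      intro j k hjk
      refine Ioo_subset_Ioo_left ?_
      have : (j : ℝ) ≤ k := by exact_mod_cast hjk
      gcongr
    rw [hU, setLIntegral_iUnion_of_directed _ (directed_of_isDirected_le hmono)]
    refine iSup_le fun k => hbound _ ⟨by positivity, ?_⟩
    rw [div_lt_iff₀ (by positivity)]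
    have : (0 : ℝ) ≤ k := by positivity
    nlinarith
  refine (lintegral_mono_set (t := Ioo 0 (a / 3) ∪ Ioo (a / 4) a) fun t ht => ?_).trans_lt
    ((lintegral_union_le _ _ _).trans_lt (ENNReal.add_lt_top.2
      ⟨hnear.trans_lt (ENNReal.rpow_lt_top_of_nonneg hp0.le hKt.ne), hZt⟩))
  by_cases h3 : t < a / 3
  · exact Or.inl ⟨ht.1, h3⟩
  · exact Or.inr ⟨by linarith, ht.2⟩

end Hardy

/-! ### Gluing functions of fractional Sobolev class -/

section Gluing

variable {E : Type*} [NormedAddCommGroup E] [NormedSpace ℝ E]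

theorem MemWsp.hardy_zero {p s a : ℝ} (hp : 1 < p) (hs : 0 < s) (hsp : s * p < 1) (ha : 0 < a)
    {f : ℝ → E} (hf : MemWsp p s 0 a f) :
    ∫⁻ t in Ioo 0 a, ‖t‖ₑ ^ (-(s * p)) * ‖f t‖ₑ ^ p < ⊤ := by
  obtain ⟨F, hF, hfF⟩ := hf.1.1
  have hW := hf.congr hfF
  have h1 := (memLp_iff_lintegral_rpow_lt_top hp hW.1.1).1 hW.1
  have h2 := (memLp_slobQuot_iff hp hW.1.1).1 hW.2
  rw [lintegral_prod _ (measurable_slobIntegrand p s hF).aemeasurable] at h2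
  refine lt_of_eq_of_lt (lintegral_congr_ae ?_) (lintegral_hardy_lt_top hp hs hsp ha hF h1 h2)
  filter_upwards [hfF] with t ht
  rw [ht]

theorem MemWsp.hardy_left {p s c b : ℝ} (hp : 1 < p) (hs : 0 < s) (hsp : s * p < 1) (hcb : c < b)
    {f : ℝ → E} (hf : MemWsp p s c b f) :
    ∫⁻ t in Ioo c b, ‖t - c‖ₑ ^ (-(s * p)) * ‖f t‖ₑ ^ p < ⊤ := by
  have h := (hf.comp_add_right (a' := 0) (b' := b - c) c (by ring) (by ring)).hardy_zero hp hs hsp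
    (sub_pos.2 hcb)
  have hm := measurePreserving_add_volIoo (a' := c) (b' := b) (a := 0) (b := b - c) (-c)
    (by ring) (by ring)
  rw [← hm.lintegral_comp_emb (measurableEmbedding_addRight (-c))] at h
  simpa [sub_eq_add_neg] using h

theorem MemWsp.hardy_right {p s a c : ℝ} (hp : 1 < p) (hs : 0 < s) (hsp : s * p < 1) (hac : a < c)
    {f : ℝ → E} (hf : MemWsp p s a c f) :
    ∫⁻ t in Ioo a c, ‖t - c‖ₑ ^ (-(s * p)) * ‖f t‖ₑ ^ p < ⊤ := by
  have h := (hf.comp_sub_left (a' := 0) (b' := c - a) c (by ring) (by ring)).hardy_zero hp hs hsp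
    (sub_pos.2 hac)
  have hm := measurePreserving_sub_volIoo (a' := a) (b' := c) (a := 0) (b := c - a) c
    (by ring) (by ring)
  rw [← hm.lintegral_comp_emb (MeasurableEquiv.subLeft c).measurableEmbedding] at h
  refine lt_of_eq_of_lt (lintegral_congr fun t => ?_) h
  rw [← enorm_neg (t - c), neg_sub, sub_sub_cancel]

theorem volIoo_add_volIoo {a c b : ℝ} (hac : a < c) (hcb : c < b) :
    volIoo a b = volIoo a c + volIoo c b := by
  have h : volIoo c b = volume.restrict (Ico c b) := restrict_Ioo_eq_restrict_Ico
  rw [h, ← Measure.restrict_union _ measurableSet_Ico, Ioo_union_Ico_eq_Ioo hac hcb.le]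
  rw [Set.disjoint_left]
  intro t ht ht'
  exact absurd ht.2 (not_lt.2 ht'.1)

/-- The interaction of the two sides of `c` in the Slobodeckij seminorm is finite: integrating the
kernel over the other side leaves the weight of Hardy's inequality. -/
theorem lintegral_cross_lt_top {p s a c b : ℝ} (hp : 1 < p) (hs : 0 < s) (hsp : s * p < 1)
    (hac : a < c) (hcb : c < b) {f : ℝ → E} (hf : StronglyMeasurable f) (hL : MemWsp p s a c f)
    (hR : MemWsp p s c b f) :
    ∫⁻ t in Ioo a c, ∫⁻ ξ in Ioo c b, slobIntegrand p s f t ξ < ⊤ := by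
  have hsp0 : 0 < s * p := mul_pos hs (by linarith)
  have hfp : Measurable fun t => ‖f t‖ₑ ^ p := hf.enorm.pow_const p
  have hfp2 : Measurable fun z : ℝ × ℝ => ‖f z.2‖ₑ ^ p := hfp.comp measurable_snd
  set C : ℝ≥0∞ := 2 ^ (p - 1)
  set k : ℝ → ℝ → ℝ≥0∞ := fun t ξ => ‖t - ξ‖ₑ ^ (-(1 + s * p)) with hk
  have hkm : Measurable fun z : ℝ × ℝ => k z.1 z.2 := by simp only [hk]; fun_prop
  have hkm1 : ∀ t, Measurable (k t) := fun t => by simp only [hk]; fun_prop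
  have hkm2 : ∀ ξ, Measurable fun t => k t ξ := fun t => by simp only [hk]; fun_prop
  have hKR : ∀ t ∈ Ioo a c, ∫⁻ ξ in Ioo c b, k t ξ ≤
      ENNReal.ofReal (1 / (s * p)) * ‖t - c‖ₑ ^ (-(s * p)) := fun t ht =>
    lintegral_far_kernel hsp0 (Or.inl ⟨Ioo_subset_Ioi_self, ht.2⟩)
  have hKL : ∀ ξ ∈ Ioo c b, ∫⁻ t in Ioo a c, k t ξ ≤
      ENNReal.ofReal (1 / (s * p)) * ‖ξ - c‖ₑ ^ (-(s * p)) := fun ξ hξ => by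
    refine (lintegral_mono fun t => ?_).trans
      (lintegral_far_kernel hsp0 (Or.inr ⟨(Ioo_subset_Iio_self : Ioo a c ⊆ _), hξ.1⟩))
    simp only [hk]
    rw [← enorm_neg, neg_sub]
  calc ∫⁻ t in Ioo a c, ∫⁻ ξ in Ioo c b, slobIntegrand p s f t ξ
      ≤ ∫⁻ t in Ioo a c, ∫⁻ ξ in Ioo c b, C * (k t ξ * ‖f t‖ₑ ^ p + k t ξ * ‖f ξ‖ₑ ^ p) := by
        refine lintegral_mono fun t => lintegral_mono fun ξ => ?_
        simp only [slobIntegrand]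
        rw [← mul_add, mul_left_comm]
        gcongr
        exact (ENNReal.rpow_le_rpow enorm_sub_le (by linarith)).trans
          (ENNReal.rpow_add_le_mul_rpow_add_rpow _ _ hp.le)
    _ = C * (∫⁻ t in Ioo a c, (∫⁻ ξ in Ioo c b, k t ξ) * ‖f t‖ₑ ^ p) +
          C * ∫⁻ ξ in Ioo c b, (∫⁻ t in Ioo a c, k t ξ) * ‖f ξ‖ₑ ^ p := by
        have h1 : ∀ t, ∫⁻ ξ in Ioo c b, C * (k t ξ * ‖f t‖ₑ ^ p + k t ξ * ‖f ξ‖ₑ ^ p) =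
            C * ((∫⁻ ξ in Ioo c b, k t ξ) * ‖f t‖ₑ ^ p) +
              C * ∫⁻ ξ in Ioo c b, k t ξ * ‖f ξ‖ₑ ^ p := fun t => by
          have h1 := hkm1 t
          rw [lintegral_const_mul _ (by fun_prop), lintegral_add_left (by fun_prop),
            lintegral_mul_const _ (by fun_prop), mul_add]
        have hI : Measurable fun t => ∫⁻ ξ in Ioo c b, k t ξ := hkm.lintegral_prod_right'
        have hI2 : Measurable fun t => ∫⁻ ξ in Ioo c b, k t ξ * ‖f ξ‖ₑ ^ p :=
          (hkm.mul hfp2).lintegral_prod_right'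
        simp_rw [h1]
        rw [lintegral_add_left (by fun_prop), lintegral_const_mul _ (by fun_prop),
          lintegral_const_mul _ hI2, lintegral_lintegral_swap (hkm.mul hfp2).aemeasurable]
        congr 2
        refine lintegral_congr fun ξ => ?_
        rw [lintegral_mul_const _ (hkm2 ξ)]
    _ ≤ C * (∫⁻ t in Ioo a c, ENNReal.ofReal (1 / (s * p)) *
            (‖t - c‖ₑ ^ (-(s * p)) * ‖f t‖ₑ ^ p)) +
          C * ∫⁻ ξ in Ioo c b, ENNReal.ofReal (1 / (s * p)) *
            (‖ξ - c‖ₑ ^ (-(s * p)) * ‖f ξ‖ₑ ^ p) := by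
        gcongr C * ?_ + C * ?_
        · refine setLIntegral_mono' measurableSet_Ioo fun t ht => ?_
          rw [← mul_assoc]
          gcongr
          exact hKR t ht
        · refine setLIntegral_mono' measurableSet_Ioo fun t ht => ?_
          rw [← mul_assoc]
          gcongr
          exact hKL t ht
    _ < ⊤ := by
        have hCt : C < ⊤ := ENNReal.rpow_lt_top_of_nonneg (by linarith) (by simp)
        rw [lintegral_const_mul' _ _ (by simp), lintegral_const_mul' _ _ (by simp)]
        exact ENNReal.add_lt_top.2
          ⟨ENNReal.mul_lt_top hCt (ENNReal.mul_lt_top (by simp) (hL.hardy_right hp hs hsp hac)),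
            ENNReal.mul_lt_top hCt (ENNReal.mul_lt_top (by simp) (hR.hardy_left hp hs hsp hcb))⟩

/-- In the range `s p < 1` functions of fractional Sobolev class on two adjacent intervals glue to
a function of the same class, with no matching condition at the common end point. -/
theorem MemWsp.glue {p s a c b : ℝ} (hp : 1 < p) (hs : 0 < s) (hsp : s * p < 1)
    (hac : a < c) (hcb : c < b) {f : ℝ → E} (hL : MemWsp p s a c f) (hR : MemWsp p s c b f) :
    MemWsp p s a b f := by
  have hμ := volIoo_add_volIoo hac hcb
  have hfm : AEStronglyMeasurable f (volIoo a b) := by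
    rw [hμ]; exact hL.1.1.add_measure hR.1.1
  obtain ⟨F, hF, hfF⟩ := hfm
  have hfF' := hfF
  rw [hμ] at hfF'
  obtain ⟨hfL, hfR⟩ := ae_add_measure_iff.1 hfF'
  replace hL : MemWsp p s a c F := hL.congr hfL
  replace hR : MemWsp p s c b F := hR.congr hfR
  refine MemWsp.congr (f := F) ⟨?_, ?_⟩ hfF.symm
  · rw [memLp_iff_lintegral_rpow_lt_top hp hF.aestronglyMeasurable, hμ, lintegral_add_measure]
    exact ENNReal.add_lt_top.2 ⟨(memLp_iff_lintegral_rpow_lt_top hp hL.1.1).1 hL.1,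
      (memLp_iff_lintegral_rpow_lt_top hp hR.1.1).1 hR.1⟩
  · have hm := measurable_slobIntegrand p s hF
    have hcross := lintegral_cross_lt_top hp hs hsp hac hcb hF hL hR
    rw [memLp_slobQuot_iff hp hF.aestronglyMeasurable, hμ, Measure.prod_add, Measure.add_prod,
      Measure.add_prod, lintegral_add_measure, lintegral_add_measure, lintegral_add_measure]
    refine ENNReal.add_lt_top.2 ⟨ENNReal.add_lt_top.2 ⟨(memLp_slobQuot_iff hp hL.1.1).1 hL.2, ?_⟩,
      ENNReal.add_lt_top.2 ⟨?_, (memLp_slobQuot_iff hp hR.1.1).1 hR.2⟩⟩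
    · rw [lintegral_prod_symm _ hm.aemeasurable,
        lintegral_congr fun _ => lintegral_congr fun _ => slobIntegrand_comm p s F _ _]
      exact hcross
    · rwa [lintegral_prod _ hm.aemeasurable]

end Gluing

/-! ### Completeness of the space `𝔹` -/

namespace System

variable {n : ℕ} {S : System n}

/-- The square of the interval `(-T-σ, 0)`, on which the Slobodeckij seminorm of `𝔹` is taken. -/
abbrev slobMeasure (S : System n) : Measure (ℝ × ℝ) :=
  (volIoo (-S.T - S.σ) 0).prod (volIoo (-S.T - S.σ) 0)

theorem BSpace.norm_toLp_le (f : S.BSpace) : ‖f.toLp‖ ≤ ‖f‖ := by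
  rw [BSpace.norm_def, Lp.norm_def]
  exact le_add_of_nonneg_right (by positivity)

/-- The inclusion of `𝔹` into `L_p(-2T, 0)`. -/
def BSpace.inclusion (S : System n) : S.BSpace →L[ℂ] S.LpC (-2 * S.T) 0 :=
  LinearMap.mkContinuous ⟨⟨BSpace.toLp, BSpace.toLp_add⟩, BSpace.toLp_smul⟩ 1 fun f => by
    simpa using f.norm_toLp_le

theorem BSpace.inclusion_apply (f : S.BSpace) : BSpace.inclusion S f = f.toLp := rfl

theorem BSpace.memLp_slobQuot (f : S.BSpace) :
    MemLp (slobQuot S.p S.s f.toLp) S.q S.slobMeasure :=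
  f.memB.2.2

/-- The difference quotient, as a bounded operator from `𝔹` to `L_p`. -/
def BSpace.quot (S : System n) : S.BSpace →L[ℂ] Lp (Fin (n + 1) → ℂ) S.q S.slobMeasure :=
  LinearMap.mkContinuous
    { toFun := fun f => f.memLp_slobQuot.toLp _
      map_add' := fun f g => by
        rw [← MemLp.toLp_add]
        refine MemLp.toLp_congr _ _ ?_
        rw [← slobQuot_add]
        exact slobQuot_congr _ _ (S.ae_volIoo (Lp.coeFn_add f.toLp g.toLp))
      map_smul' := fun c f => by
        rw [RingHom.id_apply, ← MemLp.toLp_const_smul]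
        refine MemLp.toLp_congr _ _ ?_
        rw [← slobQuot_smul]
        exact slobQuot_congr _ _ (S.ae_volIoo (Lp.coeFn_smul c f.toLp)) } 1 fun f => by
    rw [one_mul, BSpace.norm_def]
    refine (Lp.norm_toLp _ f.memLp_slobQuot).trans_le ?_
    rw [← add_assoc]
    exact le_add_of_nonneg_left (by positivity)

theorem BSpace.coeFn_quot (f : S.BSpace) :
    BSpace.quot S f =ᵐ[S.slobMeasure] slobQuot S.p S.s f.toLp :=
  f.memLp_slobQuot.coeFn_toLp

theorem BSpace.norm_le (f : S.BSpace) :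
    ‖f‖ ≤ 2 * ‖BSpace.inclusion S f‖ + ‖BSpace.quot S f‖ := by
  have h1 : ‖BSpace.quot S f‖ = (eLpNorm (slobQuot S.p S.s f.toLp) S.q S.slobMeasure).toReal :=
    Lp.norm_toLp _ f.memLp_slobQuot
  have h2 : (eLpNorm f.toLp S.q (volIoo (-S.T - S.σ) 0)).toReal ≤ ‖f.toLp‖ := by
    rw [Lp.norm_def]
    exact ENNReal.toReal_mono (Lp.eLpNorm_ne_top _) (eLpNorm_mono_measure _ S.volIoo_le)
  rw [h1, BSpace.inclusion_apply, BSpace.norm_def]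
  rw [Lp.norm_def] at *
  linarith

/-- The difference quotient of an `L_p` limit is the `L_p` limit of the difference quotients, since
both are almost everywhere limits along a subsequence; so the norm of `𝔹` is complete. -/
instance : CompleteSpace S.BSpace := by
  refine Metric.complete_of_cauchySeq_tendsto fun f hf => ?_
  obtain ⟨F, hF⟩ := cauchySeq_tendsto_of_complete
    ((BSpace.inclusion S).uniformContinuous.comp_cauchySeq hf)
  obtain ⟨Q, hQ⟩ := cauchySeq_tendsto_of_complete
    ((BSpace.quot S).uniformContinuous.comp_cauchySeq hf)
  obtain ⟨φ, hφ, hFφ⟩ := (tendstoInMeasure_of_tendsto_Lp hF).exists_seq_tendsto_ae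
  obtain ⟨ψ, hψ, hQψ⟩ := (tendstoInMeasure_of_tendsto_Lp
    (hQ.comp hφ.tendsto_atTop)).exists_seq_tendsto_ae
  have hQae : Q =ᵐ[S.slobMeasure] slobQuot S.p S.s F := by
    have h0 : ∀ᵐ t ∂volIoo (-S.T - S.σ) 0,
        Tendsto (fun i => (f (φ (ψ i))).toLp t) atTop (𝓝 (F t)) := by
      refine S.ae_volIoo (hFφ.mono fun t ht => ?_)
      exact ht.comp hψ.tendsto_atTop
    have h1 := Measure.quasiMeasurePreserving_fst (μ := volIoo (-S.T - S.σ) 0)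
      (ν := volIoo (-S.T - S.σ) 0) |>.ae h0
    have h2 := Measure.quasiMeasurePreserving_snd (μ := volIoo (-S.T - S.σ) 0)
      (ν := volIoo (-S.T - S.σ) 0) |>.ae h0
    have h3 : ∀ᵐ z ∂S.slobMeasure, ∀ i,
        BSpace.quot S (f (φ (ψ i))) z = slobQuot S.p S.s (f (φ (ψ i))).toLp z :=
      ae_all_iff.2 fun i => BSpace.coeFn_quot _
    filter_upwards [h1, h2, h3, hQψ] with z hz1 hz2 hz3 hz4
    refine tendsto_nhds_unique hz4 ?_
    simp only [Function.comp_apply, hz3]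
    exact (hz1.sub hz2).const_smul _
  have hmem : S.MemB F := by
    refine ⟨Lp.memLp F, (Lp.memLp F).mono_measure S.volIoo_le, ?_⟩
    exact (memLp_congr_ae hQae).1 (Lp.memLp Q)
  let G : S.BSpace := (⟨F, hmem⟩ : S.BSub)
  have hGF : BSpace.inclusion S G = F := rfl
  have hGQ : BSpace.quot S G = Q := Lp.ext ((BSpace.coeFn_quot G).trans hQae.symm)
  refine ⟨G, tendsto_iff_norm_sub_tendsto_zero.2 ?_⟩
  have hlim := ((tendsto_iff_norm_sub_tendsto_zero.1 hF).const_mul 2).add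
    (tendsto_iff_norm_sub_tendsto_zero.1 hQ)
  rw [mul_zero, zero_add] at hlim
  refine squeeze_zero (fun _ => norm_nonneg _) (fun i => ?_) hlim
  have := BSpace.norm_le (f i - G)
  rwa [map_sub, map_sub, hGF, hGQ] at this

end System

/-! ### Regularity of the periodic solution -/

section Periodic

variable {n : ℕ} {S : System n} (P : PeriodicSolution S)

theorem norm_toC {ι : Type*} [Fintype ι] (v : ι → ℝ) : ‖toC v‖ = ‖v‖ := by
  simp [toC, Pi.norm_def]

theorem toC_sub {ι : Type*} (v w : ι → ℝ) : toC (v - w) = toC v - toC w := by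
  funext i; simp [toC]

theorem continuous_toC {ι : Type*} : Continuous (toC : (ι → ℝ) → ι → ℂ) := by
  unfold toC; fun_prop

theorem relay_mem (α β : ℝ) (g : ℝ → ℝ) (t : ℝ) : relay α β g t ∈ ({1, -1} : Set ℝ) := by
  unfold relay
  simp only [mem_insert_iff, mem_singleton_iff]
  split_ifs <;> simp

/-- Between two consecutive switching times the relay is constant. -/
theorem PeriodicSolution.exists_relay_eq {τ : ℝ} (hτ : τ = 0 ∨ τ = S.T) :
    ∃ h : ℝ, ∀ t ∈ Ioo τ (τ + S.T), relay S.α S.β (fun r => S.M (P.u r)) t = h := by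
  have hT := S.T_pos
  have hc : ContinuousOn (relay S.α S.β fun r => S.M (P.u r)) (Ioo τ (τ + S.T)) := by
    intro t ht
    refine ContinuousAt.continuousWithinAt ?_
    by_contra hcon
    have hmem : t ∈ {t ∈ Ioc 0 (2 * S.T) |
        ¬ ContinuousAt (relay S.α S.β (fun r => S.M (P.u r))) t} := by
      refine ⟨?_, hcon⟩
      rcases hτ with rfl | rfl <;> constructor <;> linarith [ht.1, ht.2]
    rw [P.switching] at hmem
    have h1 := ht.1
    have h2 := ht.2
    rcases hmem with h | h <;> rcases hτ with rfl | rfl <;> rw [h] at h1 h2 <;> linarith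
  refine ⟨_, fun t ht => isPreconnected_Ioo.constant_of_mapsTo (T := {1, -1})
    (Set.toFinite _).isDiscrete hc
    (fun t _ => relay_mem _ _ _ t) ht (y := τ + S.T / 2) ?_⟩
  constructor <;> linarith

/-- On `(0, 2T)` the delayed argument `u(t - 2T)` is `u(t)` by periodicity, so that the periodic
solution satisfies an ordinary differential equation. -/
theorem PeriodicSolution.exists_weak_deriv : ∃ g : ℝ → Fin (n + 1) → ℝ,
    IsW1p S.p 0 (2 * S.T) P.u g ∧ ∀ᵐ t ∂volIoo 0 (2 * S.T),
      g t = relay S.α S.β (fun r => S.M (P.u r)) t • S.k + (S.A - S.B).mulVec (P.u t) := by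
  have hT := S.T_pos
  obtain ⟨-, ⟨g, hg, hgu⟩, hφ, -⟩ := P.isSolution (2 * S.T) (by linarith)
  refine ⟨g, hg, ?_⟩
  have hper : ∀ᵐ ξ ∂volIoo (-2 * S.T) 0, P.u (2 * S.T + ξ) = P.u ξ := by
    filter_upwards [hφ, P.periodic_φ] with ξ h1 h2
    rw [h1, h2]
  have hper' := (measurePreserving_add_volIoo (a' := 0) (b' := 2 * S.T) (a := -2 * S.T) (b := 0)
    (-(2 * S.T)) (by ring) (by ring)).quasiMeasurePreserving.ae hper
  filter_upwards [hgu, hper'] with t h1 h2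
  rw [h1, sub_eq_add_neg t, ← h2, Matrix.sub_mulVec]
  rw [show 2 * S.T + (t + -(2 * S.T)) = t by ring]
  abel

theorem PeriodicSolution.continuousOn_u : ContinuousOn P.u (Icc 0 (2 * S.T)) := by
  obtain ⟨g, ⟨-, hg, hu⟩, -⟩ := P.exists_weak_deriv
  have hT := S.T_pos
  have hi : IntegrableOn g (uIcc 0 (2 * S.T)) := by
    rw [uIcc_of_le (by linarith), integrableOn_Icc_iff_integrableOn_Ioo]
    exact hg.integrable S.fact_one_le_q.out
  have hc := intervalIntegral.continuousOn_primitive_interval hi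
  rw [uIcc_of_le (by linarith)] at hc
  exact (continuousOn_const.add hc).congr hu

/-- Between switching times the periodic solution is a classical solution of the ordinary
differential equation `u' = h k + (A - B) u`. -/
theorem PeriodicSolution.exists_deriv_u_eq {τ : ℝ} (hτ : τ = 0 ∨ τ = S.T) :
    ∃ h : ℝ, ∀ t ∈ Ioo τ (τ + S.T), deriv P.u t = h • S.k + (S.A - S.B).mulVec (P.u t) := by
  have hT := S.T_pos
  obtain ⟨h, hh⟩ := P.exists_relay_eq hτ
  obtain ⟨g, ⟨-, hg, hu⟩, hgu⟩ := P.exists_weak_deriv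
  refine ⟨h, fun t ht => ?_⟩
  have hτ0 : 0 ≤ τ ∧ τ + S.T ≤ 2 * S.T := by
    rcases hτ with rfl | rfl <;> constructor <;> linarith
  have hsub : Ioo τ (τ + S.T) ⊆ Ioo 0 (2 * S.T) := Ioo_subset_Ioo hτ0.1 hτ0.2
  set F : ℝ → Fin (n + 1) → ℝ := fun r => h • S.k + (S.A - S.B).mulVec (P.u r) with hF
  have hFc : ContinuousOn F (Icc 0 (2 * S.T)) := by
    refine continuousOn_const.add ?_
    exact ((S.A - S.B).mulVecLin.continuous_of_finiteDimensional).comp_continuousOn P.continuousOn_u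
  have hgi : IntegrableOn g (Icc 0 (2 * S.T)) := by
    rw [integrableOn_Icc_iff_integrableOn_Ioo]
    exact hg.integrable S.fact_one_le_q.out
  have hgi' : ∀ x ∈ Icc 0 (2 * S.T), ∀ y ∈ Icc 0 (2 * S.T), IntervalIntegrable g volume x y :=
    fun x hx y hy => (hgi.mono_set (ordConnected_Icc.uIcc_subset hx hy)).intervalIntegrable
  have hprim : ∀ r ∈ Ioo τ (τ + S.T), P.u r = P.u τ + ∫ ξ in τ..r, F ξ := by
    intro r hr
    have hτI : τ ∈ Icc 0 (2 * S.T) := ⟨hτ0.1, by linarith⟩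
    have hrI : r ∈ Icc 0 (2 * S.T) := Ioo_subset_Icc_self (hsub hr)
    have h0I : (0 : ℝ) ∈ Icc 0 (2 * S.T) := ⟨le_rfl, by linarith⟩
    have h1 : ∫ ξ in τ..r, F ξ = ∫ ξ in τ..r, g ξ := by
      refine intervalIntegral.integral_congr_ae_restrict ?_
      rw [uIoc_of_le hr.1.le, ← restrict_Ioo_eq_restrict_Ioc]
      have h2 := ae_mono (Measure.restrict_mono (Ioo_subset_Ioo hτ0.1 (hr.2.le.trans hτ0.2)) le_rfl)
        hgu
      filter_upwards [h2, ae_restrict_mem measurableSet_Ioo] with ξ hξ hξI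
      rw [hξ, hh ξ ⟨hξI.1, hξI.2.trans hr.2⟩]
    rw [h1, hu r hrI, hu τ hτI, add_assoc,
      intervalIntegral.integral_add_adjacent_intervals (hgi' _ h0I _ hτI) (hgi' _ hτI _ hrI)]
  have hFi : IntervalIntegrable F volume τ t := by
    refine (hFc.mono ?_).intervalIntegrable
    rw [uIcc_of_le ht.1.le]
    exact Icc_subset_Icc hτ0.1 (ht.2.le.trans hτ0.2)
  have hd := intervalIntegral.integral_hasDerivAt_right hFi
    ((hFc.mono Ioo_subset_Icc_self).stronglyMeasurableAtFilter isOpen_Ioo t (hsub ht))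
    (hFc.continuousAt (Icc_mem_nhds (hsub ht).1 (hsub ht).2))
  refine ((hd.const_add (P.u τ)).congr_of_eventuallyEq ?_).deriv
  filter_upwards [Ioo_mem_nhds ht.1 ht.2] with r hr using hprim r hr

theorem PeriodicSolution.tendsto_dphi : Tendsto P.dphi (𝓝[<] (-S.T)) (𝓝 P.dphiLeft) := by
  have hT := S.T_pos
  obtain ⟨h, hh⟩ := P.exists_deriv_u_eq (Or.inl rfl)
  have hlim : Tendsto (fun θ => toC (h • S.k + (S.A - S.B).mulVec (P.u (2 * S.T + θ))))
      (𝓝[<] (-S.T)) (𝓝 (toC (h • S.k + (S.A - S.B).mulVec (P.u (2 * S.T + -S.T))))) := by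
    have hu : ContinuousAt P.u (2 * S.T + -S.T) :=
      P.continuousOn_u.continuousAt (Icc_mem_nhds (by linarith) (by linarith))
    have hc : ContinuousAt (fun θ => P.u (2 * S.T + θ)) (-S.T) :=
      ContinuousAt.comp (f := fun θ => 2 * S.T + θ) hu (by fun_prop)
    have hm : Continuous fun v : Fin (n + 1) → ℝ => toC (h • S.k + (S.A - S.B).mulVec v) :=
      continuous_toC.comp (continuous_const.add
        (S.A - S.B).mulVecLin.continuous_of_finiteDimensional)
    exact (hm.continuousAt.comp hc).tendsto.mono_left nhdsWithin_le_nhds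
  have hlim' := hlim.congr' (f₂ := P.dphi) (by
    filter_upwards [Ioo_mem_nhdsLT (show -2 * S.T < -S.T by linarith)] with θ hθ
    rw [P.dphi_eq, hh]
    constructor <;> linarith [hθ.1, hθ.2])
  exact tendsto_nhds_limUnder ⟨_, hlim'⟩

/-- The derivative of the periodic solution is of class `W_p^s` between switching times, because
there it is an affine function of the solution itself, which is of class `W_p^1`. -/
theorem PeriodicSolution.memWsp_deriv_u {τ : ℝ} (hτ : τ = 0 ∨ τ = S.T)
    (hm : MemLp (fun t => toC (deriv P.u t)) S.q (volIoo τ (τ + S.T))) :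
    MemWsp S.p S.s τ (τ + S.T) fun t => toC (deriv P.u t) := by
  have hT := S.T_pos
  have hps := (lt_min_iff.1 S.p_lt).2
  have hτ0 : 0 ≤ τ ∧ τ + S.T ≤ 2 * S.T := by
    rcases hτ with rfl | rfl <;> constructor <;> linarith
  obtain ⟨h, hh⟩ := P.exists_deriv_u_eq hτ
  obtain ⟨g, ⟨-, hg, hu⟩, -⟩ := P.exists_weak_deriv
  have hgi : IntegrableOn g (Icc 0 (2 * S.T)) := by
    rw [integrableOn_Icc_iff_integrableOn_Ioo]
    exact hg.integrable S.fact_one_le_q.out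
  have hgi' : ∀ x ∈ Icc 0 (2 * S.T), ∀ y ∈ Icc 0 (2 * S.T), IntervalIntegrable g volume x y :=
    fun x hx y hy => (hgi.mono_set (ordConnected_Icc.uIcc_subset hx hy)).intervalIntegrable
  have hle : volIoo τ (τ + S.T) ≤ volIoo 0 (2 * S.T) :=
    Measure.restrict_mono (Ioo_subset_Ioo hτ0.1 hτ0.2) le_rfl
  have hg' := hg.mono_measure hle
  set Λ := LinearMap.toContinuousLinearMap (S.A - S.B).mulVecLin
  refine memWsp_of_upperGradient S.one_lt_p S.s_lt_one
    ((lt_div_iff₀ (by linarith [S.s_lt_one])).1 hps) hm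
    (G := fun r => ‖Λ‖ₑ * ‖g r‖ₑ) (hg'.1.enorm.const_mul _) ?_ ?_
  · have hp0 : 0 ≤ S.p := by linarith [S.one_lt_p]
    simp_rw [ENNReal.mul_rpow_of_nonneg _ _ hp0]
    rw [lintegral_const_mul' _ _ (ENNReal.rpow_ne_top_of_nonneg hp0 enorm_ne_top)]
    exact ENNReal.mul_lt_top (ENNReal.rpow_lt_top_of_nonneg hp0 enorm_ne_top)
      ((memLp_iff_lintegral_rpow_lt_top S.one_lt_p hg'.1).1 hg')
  · intro t ht ξ hξ
    have htI : t ∈ Icc 0 (2 * S.T) := ⟨by linarith [ht.1], by linarith [ht.2]⟩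
    have hξI : ξ ∈ Icc 0 (2 * S.T) := ⟨by linarith [hξ.1], by linarith [hξ.2]⟩
    have h0I : (0 : ℝ) ∈ Icc 0 (2 * S.T) := ⟨le_rfl, by linarith⟩
    have hdiff : P.u t - P.u ξ = ∫ r in ξ..t, g r := by
      rw [hu t htI, hu ξ hξI, add_sub_add_left_eq_sub,
        intervalIntegral.integral_interval_sub_left (hgi' _ h0I _ htI) (hgi' _ h0I _ hξI)]
    have hval : toC (deriv P.u t) - toC (deriv P.u ξ) = toC (Λ (P.u t - P.u ξ)) := by
      rw [← toC_sub, hh t ht, hh ξ hξ, add_sub_add_left_eq_sub, ← Matrix.mulVec_sub]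
      rfl
    rw [lintegral_const_mul' _ _ enorm_ne_top, hval, hdiff, ← ofReal_norm, norm_toC, ofReal_norm]
    refine (Λ.le_opENorm _).trans ?_
    gcongr
    rw [← ofReal_norm, intervalIntegral.norm_intervalIntegral_eq, ofReal_norm]
    exact enorm_integral_le_lintegral_enorm _

theorem PeriodicSolution.memWsp_dphi {c : ℝ} (hc : c = 0 ∨ c = -S.T) :
    MemWsp S.p S.s (-S.T) 0 fun θ => P.dphi (θ + c) := by
  have hT := S.T_pos
  have hc0 : 0 ≤ 2 * S.T + c - S.T ∧ c ≤ 0 := by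
    rcases hc with rfl | rfl <;> constructor <;> linarith
  have hm := (P.memLp_dphi hc0.1 hc0.2).comp_measurePreserving
    (measurePreserving_add_volIoo (a' := S.T + c) (b' := S.T + c + S.T) (a := -S.T) (b := 0)
      (-(2 * S.T + c)) (by ring) (by ring))
  have he : ((fun θ => P.dphi (θ + c)) ∘ fun θ => θ + -(2 * S.T + c))
      = fun t => toC (deriv P.u t) := by
    funext t
    simp only [Function.comp_apply]
    rw [P.dphi_eq]
    congr 2
    ring
  rw [he] at hm
  have := (P.memWsp_deriv_u (τ := S.T + c) (by rcases hc with rfl | rfl <;> simp) hm).comp_add_right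
    (a' := -S.T) (b' := 0) (2 * S.T + c) (by ring) (by ring)
  refine (congrArg _ (funext fun θ => ?_)).mp this
  rw [P.dphi_eq]
  congr 2
  ring

end Periodic

/-! ### Regularity and boundedness of the Volterra part -/

section VolterraEstimates

variable {n : ℕ} (S : System n)

/-- On compact intervals the matrices `e^{tB}` are bounded and depend on `t` in a Lipschitz way. -/
theorem System.exists_expB_bounds : ∃ C : ℝ, 0 ≤ C ∧ ∀ t ∈ Icc (-S.T) S.T, ∀ v,
    ‖(S.expB t).mulVec v‖ ≤ C * ‖v‖ ∧ ∀ t' ∈ Icc (-S.T) S.T,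
      ‖(S.expB t).mulVec v - (S.expB t').mulVec v‖ ≤ C * |t - t'| * ‖v‖ := by
  open scoped Matrix.Norms.Operator in
  set B := S.B.map Complex.ofReal
  obtain ⟨C, hC⟩ := (isCompact_Icc (a := -S.T) (b := S.T)).exists_bound_of_continuousOn
    S.continuous_expB.continuousOn
  have hC0 : 0 ≤ C := (norm_nonneg _).trans (hC 0 ⟨by linarith [S.T_pos], S.T_pos.le⟩)
  refine ⟨max C (C * ‖B‖), hC0.trans (le_max_left _ _), fun t ht v => ⟨?_, fun t' ht' => ?_⟩⟩
  · refine (Matrix.linfty_opNorm_mulVec _ _).trans ?_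
    gcongr
    exact (hC t ht).trans (le_max_left _ _)
  · rw [← Matrix.sub_mulVec]
    refine (Matrix.linfty_opNorm_mulVec _ _).trans ?_
    gcongr
    have h := Convex.norm_image_sub_le_of_norm_hasDerivWithin_le (f := S.expB)
      (f' := fun t => S.expB t * B) (s := Icc (-S.T) S.T) (C := max C (C * ‖B‖)) (x := t') (y := t)
      (fun x _ => (hasDerivAt_exp_smul_const B x).hasDerivWithinAt) (fun x hx => ?_)
      (convex_Icc _ _) ht' ht
    · rwa [Real.norm_eq_abs] at h
    · refine (norm_mul_le _ _).trans (le_trans ?_ (le_max_right _ _))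
      gcongr
      exact hC x hx

theorem System.exists_kernel_bound : ∃ C : ℝ, 0 ≤ C ∧ ∀ θ ∈ Icc (-S.T) 0, ∀ ξ ∈ Icc (-S.T) 0,
    ∀ v, ‖(S.expB (ξ - θ)).mulVec (S.AC.mulVec v)‖ ≤ C * ‖v‖ := by
  obtain ⟨C, hC0, hC⟩ := S.exists_expB_bounds
  set Λ := LinearMap.toContinuousLinearMap S.AC.mulVecLin
  refine ⟨C * ‖Λ‖, by positivity, fun θ hθ ξ hξ v => ?_⟩
  refine ((hC (ξ - θ) ⟨by linarith [hξ.1, hθ.2], by linarith [hξ.2, hθ.1]⟩ _).1).trans ?_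
  rw [mul_assoc]
  gcongr
  exact Λ.le_opNorm v

theorem System.integrableOn_of_memLp {E : Type*} [NormedAddCommGroup E] {ν : ℝ → E}
    (hν : MemLp ν S.q (volIoo (-S.T) 0)) : IntegrableOn ν (Icc (-S.T) 0) := by
  rw [integrableOn_Icc_iff_integrableOn_Ioo]
  exact hν.integrable S.fact_one_le_q.out

theorem System.intervalIntegrable_of_memLp {E : Type*} [NormedAddCommGroup E] {ν : ℝ → E}
    (hν : MemLp ν S.q (volIoo (-S.T) 0)) {x y : ℝ} (hx : x ∈ Icc (-S.T) 0) (hy : y ∈ Icc (-S.T) 0) :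
    IntervalIntegrable ν volume x y :=
  ((S.integrableOn_of_memLp hν).mono_set (ordConnected_Icc.uIcc_subset hx hy)).intervalIntegrable

theorem System.norm_volFun_le {C : ℝ} (hC : ∀ θ ∈ Icc (-S.T) 0, ∀ ξ ∈ Icc (-S.T) 0,
    ∀ v, ‖(S.expB (ξ - θ)).mulVec (S.AC.mulVec v)‖ ≤ C * ‖v‖) {ν : ℝ → Fin (n + 1) → ℂ}
    (hν : MemLp ν S.q (volIoo (-S.T) 0)) {θ : ℝ} (hθ : θ ∈ Icc (-S.T) 0) :
    ‖S.volFun ν θ‖ ≤ C * ∫ ξ in (-S.T)..θ, ‖ν ξ‖ := by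
  have h0 : -S.T ∈ Icc (-S.T) 0 := left_mem_Icc.2 (by linarith [S.T_pos])
  rw [← intervalIntegral.integral_const_mul]
  refine (intervalIntegral.norm_integral_le_integral_norm hθ.1).trans ?_
  refine intervalIntegral.integral_mono_on hθ.1 (S.intervalIntegrable_kernel hν h0 hθ θ).norm
    ((S.intervalIntegrable_of_memLp hν h0 hθ).norm.const_mul C) fun ξ hξ => ?_
  exact hC θ hθ ξ ⟨hξ.1, hξ.2.trans hθ.2⟩ _

/-- Multiplication by `e^{-θB}` keeps bounded functions of class `W_p^1` in `W_p^s`. -/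
theorem System.memWsp_expB_mulVec {F : ℝ → Fin (n + 1) → ℂ} {M : ℝ} {g : ℝ → ℝ}
    (hg0 : ∀ r, 0 ≤ g r) (hg : MemLp g S.q (volIoo (-S.T) 0))
    (hM : ∀ t ∈ Ioo (-S.T) 0, ‖F t‖ ≤ M)
    (hF : ∀ t ∈ Ioo (-S.T) 0, ∀ ξ ∈ Ioo (-S.T) 0, ‖F t - F ξ‖ ≤ ∫ r in uIoc ξ t, g r)
    (hm : MemLp (fun θ => (S.expB (-θ)).mulVec (F θ)) S.q (volIoo (-S.T) 0)) :
    MemWsp S.p S.s (-S.T) 0 fun θ => (S.expB (-θ)).mulVec (F θ) := by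
  have hT := S.T_pos
  have hps := (lt_min_iff.1 S.p_lt).2
  obtain ⟨C, hC0, hC⟩ := S.exists_expB_bounds
  have hM0 : 0 ≤ M := (norm_nonneg _).trans (hM (-S.T / 2) ⟨by linarith, by linarith⟩)
  have hG : MemLp (fun r => C * g r + C * M) S.q (volIoo (-S.T) 0) :=
    (hg.const_mul C).add (memLp_const _)
  refine memWsp_of_upperGradient S.one_lt_p S.s_lt_one
    ((lt_div_iff₀ (by linarith [S.s_lt_one])).1 hps) hm
    (G := fun r => ‖C * g r + C * M‖ₑ) hG.1.enorm
    ((memLp_iff_lintegral_rpow_lt_top S.one_lt_p hG.1).1 hG) fun t ht ξ hξ => ?_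
  have hsub : uIoc ξ t ⊆ Icc (-S.T) 0 := uIoc_subset_uIcc.trans
    (ordConnected_Icc.uIcc_subset (Ioo_subset_Icc_self hξ) (Ioo_subset_Icc_self ht))
  have ht' : -t ∈ Icc (-S.T) S.T := ⟨by linarith [ht.2], by linarith [ht.1]⟩
  have hξ' : -ξ ∈ Icc (-S.T) S.T := ⟨by linarith [hξ.2], by linarith [hξ.1]⟩
  have hgi : IntegrableOn g (uIoc ξ t) := (S.integrableOn_of_memLp hg).mono_set hsub
  have hci : IntegrableOn (fun _ : ℝ => C * M) (uIoc ξ t) :=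
    integrableOn_const (by simp)
  have key : ‖(S.expB (-t)).mulVec (F t) - (S.expB (-ξ)).mulVec (F ξ)‖
      ≤ ∫ r in uIoc ξ t, (C * g r + C * M) := by
    rw [integral_add (hgi.const_mul C) hci, integral_const_mul, setIntegral_const, measureReal_def,
      Real.volume_uIoc, ENNReal.toReal_ofReal (abs_nonneg _), smul_eq_mul]
    calc ‖(S.expB (-t)).mulVec (F t) - (S.expB (-ξ)).mulVec (F ξ)‖
        = ‖(S.expB (-t)).mulVec (F t - F ξ)
            + ((S.expB (-t)).mulVec (F ξ) - (S.expB (-ξ)).mulVec (F ξ))‖ := by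
          rw [Matrix.mulVec_sub]; congr 1; abel
      _ ≤ C * ‖F t - F ξ‖ + C * |-t - -ξ| * ‖F ξ‖ :=
          (norm_add_le _ _).trans (add_le_add (hC _ ht' _).1 ((hC _ ht' _).2 _ hξ'))
      _ ≤ C * (∫ r in uIoc ξ t, g r) + C * |-t - -ξ| * M := by
          gcongr
          · exact hF t ht ξ hξ
          · exact hM ξ hξ
      _ = _ := by
          rw [show -t - -ξ = -(t - ξ) by ring, abs_neg]
          ring
  have hpos : ∀ r, 0 ≤ C * g r + C * M := fun r => by have := hg0 r; positivity
  rw [← ofReal_norm]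
  refine (ENNReal.ofReal_le_ofReal key).trans_eq ?_
  have hsum : IntegrableOn (fun r => C * g r + C * M) (uIoc ξ t) := (hgi.const_mul C).add hci
  rw [ofReal_integral_eq_lintegral_ofReal hsum (ae_of_all _ hpos)]
  exact lintegral_congr fun r => (Real.enorm_eq_ofReal (hpos r)).symm

theorem System.memWsp_volFun {ν : ℝ → Fin (n + 1) → ℂ} (hν : MemLp ν S.q (volIoo (-S.T) 0)) :
    MemWsp S.p S.s (-S.T) 0 (S.volFun ν) := by
  have hT := S.T_pos
  have h0 : -S.T ∈ Icc (-S.T) 0 := left_mem_Icc.2 (by linarith)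
  have h1 : (0 : ℝ) ∈ Icc (-S.T) 0 := right_mem_Icc.2 (by linarith)
  obtain ⟨C, hC0, hC⟩ := S.exists_kernel_bound
  have hC' : ∀ ξ ∈ Icc (-S.T) 0, ∀ v, ‖(S.expB ξ).mulVec (S.AC.mulVec v)‖ ≤ C * ‖v‖ := by
    simpa using hC 0 h1
  have hint : ∀ x ∈ Icc (-S.T) 0, ∀ y ∈ Icc (-S.T) 0, IntervalIntegrable
      (fun ξ => (S.expB ξ).mulVec (S.AC.mulVec (ν ξ))) volume x y := fun x hx y hy => by
    simpa using S.intervalIntegrable_kernel hν hx hy 0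
  set F : ℝ → Fin (n + 1) → ℂ :=
    fun θ => ∫ ξ in (-S.T)..θ, (S.expB ξ).mulVec (S.AC.mulVec (ν ξ)) with hF
  have hbound : ∀ x ∈ Icc (-S.T) 0, ∀ y ∈ Icc (-S.T) 0,
      ‖∫ ξ in x..y, (S.expB ξ).mulVec (S.AC.mulVec (ν ξ))‖ ≤ ∫ ξ in uIoc x y, C * ‖ν ξ‖ := by
    intro x hx y hy
    rw [intervalIntegral.norm_intervalIntegral_eq]
    refine (norm_integral_le_integral_norm _).trans ?_
    refine setIntegral_mono_on (intervalIntegrable_iff.1 (hint x hx y hy)).norm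
      ((intervalIntegrable_iff.1 (S.intervalIntegrable_of_memLp hν hx hy)).norm.const_mul C)
      measurableSet_uIoc fun ξ hξ => ?_
    exact hC' ξ (ordConnected_Icc.uIcc_subset hx hy (uIoc_subset_uIcc hξ)) _
  have hνC : MemLp (fun ξ => C * ‖ν ξ‖) S.q (volIoo (-S.T) 0) := hν.norm.const_mul C
  have heq : ∀ᵐ θ ∂volIoo (-S.T) 0, S.volFun ν θ = (S.expB (-θ)).mulVec (F θ) :=
    S.ae_of_Icc fun θ hθ => S.volFun_eq hν hθ
  refine MemWsp.congr (f := fun θ => (S.expB (-θ)).mulVec (F θ)) ?_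
    (heq.mono fun _ h => h.symm)
  refine S.memWsp_expB_mulVec (M := ∫ ξ in Icc (-S.T) 0, C * ‖ν ξ‖) (g := fun ξ => C * ‖ν ξ‖)
    (fun r => by positivity) hνC (fun t ht => ?_) (fun t ht ξ hξ => ?_)
    ((memLp_congr_ae heq).1 (S.memLp_volFun hν))
  · refine (hbound _ h0 t (Ioo_subset_Icc_self ht)).trans ?_
    refine setIntegral_mono_set (S.integrableOn_of_memLp hνC)
      (ae_of_all _ fun ξ => by simp only [Pi.zero_apply]; positivity)
      (LE.le.eventuallyLE ?_)
    exact uIoc_subset_uIcc.trans (ordConnected_Icc.uIcc_subset h0 (Ioo_subset_Icc_self ht))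
  · have ht' := Ioo_subset_Icc_self ht
    have hξ' := Ioo_subset_Icc_self hξ
    rw [hF]
    simp only
    rw [intervalIntegral.integral_interval_sub_left (hint _ h0 _ ht') (hint _ h0 _ hξ')]
    exact hbound ξ hξ' t ht'

theorem System.memWsp_expDR (z : Fin n → ℂ) :
    MemWsp S.p S.s (-S.T) 0 fun θ => (S.expB (-(θ + S.T))).mulVec (S.DR z) := by
  have h : ∀ θ, (S.expB (-(θ + S.T))).mulVec (S.DR z)
      = (S.expB (-θ)).mulVec ((S.expB (-S.T)).mulVec (S.DR z)) := fun θ => by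
    rw [Matrix.mulVec_mulVec, ← S.expB_add]
    congr 2
    ring
  simp_rw [h]
  refine S.memWsp_expB_mulVec (M := ‖(S.expB (-S.T)).mulVec (S.DR z)‖) (g := fun _ => 0)
    (fun _ => le_rfl) MemLp.zero' (fun _ _ => le_rfl) (by simp) ?_
  simp_rw [← h]
  exact S.memLp_expDR z

theorem System.exists_integral_norm_le : ∃ K : ℝ, 0 ≤ K ∧ ∀ ν : S.LpC (-S.T) 0,
    ∫ ξ in (-S.T)..0, ‖ν ξ‖ ≤ K * ‖ν‖ := by
  refine ⟨(volIoo (-S.T) 0 univ ^ (1 / (1 : ℝ≥0∞).toReal - 1 / S.q.toReal)).toReal,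
    ENNReal.toReal_nonneg, fun ν => ?_⟩
  have hT := S.T_pos
  have hfin : volIoo (-S.T) 0 univ ^ (1 / (1 : ℝ≥0∞).toReal - 1 / S.q.toReal) ≠ ⊤ := by
    refine ENNReal.rpow_ne_top_of_nonneg ?_ (by simp)
    rw [ENNReal.toReal_ofReal (by linarith [S.one_lt_p])]
    simp only [ENNReal.toReal_one, div_one, sub_nonneg]
    exact (div_le_one (by linarith [S.one_lt_p])).2 S.one_lt_p.le
  rw [intervalIntegral.integral_of_le (by linarith), ← restrict_Ioo_eq_restrict_Ioc,
    integral_norm_eq_lintegral_enorm (Lp.aestronglyMeasurable ν), ← eLpNorm_one_eq_lintegral_enorm,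
    Lp.norm_def, mul_comm, ← ENNReal.toReal_mul]
  exact ENNReal.toReal_mono (ENNReal.mul_ne_top (Lp.eLpNorm_ne_top ν) hfin)
    (eLpNorm_le_eLpNorm_mul_rpow_measure_univ S.fact_one_le_q.out (Lp.aestronglyMeasurable ν))

theorem System.coeFn_vol (ν : S.LpC (-S.T) 0) : S.vol ν =ᵐ[volIoo (-S.T) 0] S.volFun ν :=
  (S.memLp_volFun (Lp.memLp ν)).coeFn_toLp

/-- The iterated kernels of the Volterra operator are bounded by `C ^ (k+1) (θ + T) ^ k / k!`. -/
theorem System.norm_volFun_iterate_le {C : ℝ} (hC0 : 0 ≤ C)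
    (hC : ∀ θ ∈ Icc (-S.T) 0, ∀ ξ ∈ Icc (-S.T) 0,
      ∀ v, ‖(S.expB (ξ - θ)).mulVec (S.AC.mulVec v)‖ ≤ C * ‖v‖) (ν : S.LpC (-S.T) 0) (k : ℕ) :
    ∀ θ ∈ Icc (-S.T) 0, ‖S.volFun ((S.vol ^ k) ν) θ‖ ≤
      C ^ (k + 1) * ((θ + S.T) ^ k / k.factorial) * ∫ ξ in (-S.T)..0, ‖ν ξ‖ := by
  have hT := S.T_pos
  have h0 : -S.T ∈ Icc (-S.T) 0 := left_mem_Icc.2 (by linarith)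
  have h1 : (0 : ℝ) ∈ Icc (-S.T) 0 := right_mem_Icc.2 (by linarith)
  set N := ∫ ξ in (-S.T)..0, ‖ν ξ‖
  induction k with
  | zero =>
    intro θ hθ
    have h2 : ∫ ξ in (-S.T)..θ, ‖ν ξ‖ ≤ N := by
      refine intervalIntegral.integral_mono_interval le_rfl hθ.1 hθ.2
        (ae_of_all _ fun _ => norm_nonneg _) (S.intervalIntegrable_of_memLp (Lp.memLp ν) h0 h1).norm
    simpa using (S.norm_volFun_le hC (Lp.memLp ν) hθ).trans (mul_le_mul_of_nonneg_left h2 hC0)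
  | succ k ih =>
    intro θ hθ
    have hpow : (S.vol ^ (k + 1)) ν = S.vol ((S.vol ^ k) ν) := by
      rw [pow_succ']; rfl
    have hm := S.memLp_volFun (Lp.memLp ((S.vol ^ k) ν))
    rw [hpow, S.volFun_congr (S.coeFn_vol _) hθ]
    refine (S.norm_volFun_le hC hm hθ).trans ?_
    have hcont : Continuous fun ξ : ℝ => C ^ (k + 1) * ((ξ + S.T) ^ k / k.factorial) * N := by
      fun_prop
    have h2 : ∫ ξ in (-S.T)..θ, ‖S.volFun ((S.vol ^ k) ν) ξ‖ ≤
        ∫ ξ in (-S.T)..θ, C ^ (k + 1) * ((ξ + S.T) ^ k / k.factorial) * N :=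
      intervalIntegral.integral_mono_on hθ.1 (S.intervalIntegrable_of_memLp hm h0 hθ).norm
        (hcont.intervalIntegrable _ _) fun ξ hξ => ih ξ ⟨hξ.1, hξ.2.trans hθ.2⟩
    have h3 : ∫ ξ in (-S.T)..θ, C ^ (k + 1) * ((ξ + S.T) ^ k / k.factorial) * N =
        C ^ (k + 1) * ((θ + S.T) ^ (k + 1) / (k + 1).factorial) * N := by
      rw [intervalIntegral.integral_mul_const, intervalIntegral.integral_const_mul,
        intervalIntegral.integral_div,
        intervalIntegral.integral_comp_add_right (fun x : ℝ => x ^ k) S.T, integral_pow,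
        Nat.factorial_succ]
      push_cast
      rw [neg_add_cancel, zero_pow (by omega), sub_zero, div_div]
    calc C * ∫ ξ in (-S.T)..θ, ‖S.volFun ((S.vol ^ k) ν) ξ‖
        ≤ C * (C ^ (k + 1) * ((θ + S.T) ^ (k + 1) / (k + 1).factorial) * N) := by
          gcongr
          exact h2.trans_eq h3
      _ = _ := by ring

theorem System.exists_norm_vol_pow_le : ∃ K D : ℝ, ∀ (k : ℕ) (ν : S.LpC (-S.T) 0),
    ‖(S.vol ^ (k + 1)) ν‖ ≤ K * (D ^ k / k.factorial) * ‖ν‖ := by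
  have hT := S.T_pos
  obtain ⟨C, hC0, hC⟩ := S.exists_kernel_bound
  obtain ⟨K, hK0, hK⟩ := S.exists_integral_norm_le
  set m : ℝ := (measureUnivNNReal (volIoo (-S.T) 0) : ℝ) ^ S.q.toReal⁻¹ with hm
  have hm0 : 0 ≤ m := by positivity
  refine ⟨m * C * K, C * S.T, fun k ν => ?_⟩
  have hpow : (S.vol ^ (k + 1)) ν = S.vol ((S.vol ^ k) ν) := by
    rw [pow_succ']; rfl
  have hb : ∀ᵐ θ ∂volIoo (-S.T) 0, ‖(S.vol ^ (k + 1)) ν θ‖ ≤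
      C ^ (k + 1) * (S.T ^ k / k.factorial) * (K * ‖ν‖) := by
    rw [hpow]
    have h1 := S.ae_of_Icc fun θ hθ => And.intro hθ (S.norm_volFun_iterate_le hC0 hC ν k θ hθ)
    filter_upwards [S.coeFn_vol ((S.vol ^ k) ν), h1] with θ h2 ⟨hθ, h3⟩
    rw [h2]
    refine h3.trans ?_
    have h4 : 0 ≤ θ + S.T := by linarith [hθ.1]
    have h5 : θ + S.T ≤ S.T := by linarith [hθ.2]
    refine mul_le_mul (by gcongr) (hK ν) ?_ (by positivity)
    exact intervalIntegral.integral_nonneg (by linarith) fun _ _ => norm_nonneg _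
  refine (Lp.norm_le_of_ae_bound (by positivity) hb).trans_eq ?_
  rw [← hm, mul_pow]
  ring

/-- The Volterra operator as a bounded operator. -/
def System.volL : S.LpC (-S.T) 0 →L[ℂ] S.LpC (-S.T) 0 :=
  S.vol.mkContinuousOfExistsBound (by
    obtain ⟨K, D, h⟩ := S.exists_norm_vol_pow_le
    exact ⟨K, fun ν => by simpa using h 0 ν⟩)

theorem System.continuous_volZero : Continuous S.volZero := by
  obtain ⟨C, hC0, hC⟩ := S.exists_kernel_bound
  obtain ⟨K, hK0, hK⟩ := S.exists_integral_norm_le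
  refine (S.volZero.mkContinuous (C * K) fun ν => ?_).continuous
  refine (S.norm_volFun_le hC (Lp.memLp ν) (right_mem_Icc.2 (by linarith [S.T_pos]))).trans ?_
  rw [mul_assoc]
  gcongr
  exact hK ν

theorem System.volL_pow_apply (k : ℕ) (ν : S.LpC (-S.T) 0) :
    (S.volL ^ k) ν = (S.vol ^ k) ν := by
  induction k with
  | zero => simp
  | succ k ih =>
    rw [pow_succ', pow_succ', mul_apply_eq_comp, Module.End.mul_apply, ih]
    rfl

/-- The Volterra operator is quasi-nilpotent: `‖V ^ (k+1)‖` is at most `K D ^ k / k!`. -/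
theorem System.isUnit_sub_vol {μ : ℂ} (hμ : μ ≠ 0) :
    IsUnit (algebraMap ℂ (Module.End ℂ (S.LpC (-S.T) 0)) μ - S.vol) := by
  have hspec : μ ∉ spectrum ℂ S.volL := by
    intro hmem
    obtain ⟨K, D, hKD⟩ := S.exists_norm_vol_pow_le
    have hμ0 : 0 < ‖μ‖ := norm_pos_iff.2 hμ
    set c := ‖(1 : S.LpC (-S.T) 0 →L[ℂ] S.LpC (-S.T) 0)‖
    have hbound : ∀ k : ℕ, ‖μ‖ ≤ |K| * ((|D| / ‖μ‖) ^ k / k.factorial) * c := by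
      intro k
      have h1 := spectrum.norm_le_norm_mul_of_mem (spectrum.pow_mem_pow S.volL (k + 1) hmem)
      have h2 : ‖S.volL ^ (k + 1)‖ ≤ |K| * (|D| ^ k / k.factorial) := by
        refine ContinuousLinearMap.opNorm_le_bound _ (by positivity) fun ν => ?_
        rw [S.volL_pow_apply]
        refine (hKD k ν).trans ?_
        refine mul_le_mul_of_nonneg_right ?_ (norm_nonneg _)
        refine (le_abs_self _).trans_eq ?_
        rw [abs_mul, abs_div, abs_pow, Nat.abs_cast]
      rw [norm_pow, pow_succ] at h1
      have h3 : ‖μ‖ ^ k * ‖μ‖ ≤ |K| * (|D| ^ k / k.factorial) * c :=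
        h1.trans (by gcongr)
      rw [← le_div_iff₀' (by positivity)] at h3
      refine h3.trans_eq ?_
      rw [div_pow]
      field_simp
    have hlim : Tendsto (fun k : ℕ => |K| * ((|D| / ‖μ‖) ^ k / k.factorial) * c) atTop
        (𝓝 (|K| * 0 * c)) :=
      ((FloorSemiring.tendsto_pow_div_factorial_atTop _).const_mul _).mul_const _
    have := ge_of_tendsto' hlim hbound
    rw [mul_zero, zero_mul] at this
    linarith
  have hu := spectrum.notMem_iff.1 hspec
  exact hu.map (ContinuousLinearMap.toLinearMapRingHom (R₁ := ℂ) (M₁ := S.LpC (-S.T) 0))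

/-- Eliminating the second component turns the resolvent equation of `𝓥` at `μ` into the resolvent
equation of the Volterra operator at `μ ^ 2`. -/
theorem System.isUnit_sub_calV {μ : ℂ} (hμ : μ ≠ 0) :
    IsUnit (algebraMap ℂ (Module.End ℂ S.YSpace) μ - S.calV) := by
  have hb := (Module.End.isUnit_iff _).1 (S.isUnit_sub_vol (pow_ne_zero 2 hμ))
  have happ : ∀ ν, (algebraMap ℂ (Module.End ℂ (S.LpC (-S.T) 0)) (μ ^ 2) - S.vol) ν
      = (μ ^ 2) • ν - S.vol ν := fun _ => rfl
  have happY : ∀ w : S.YSpace, (algebraMap ℂ (Module.End ℂ S.YSpace) μ - S.calV) w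
      = (μ • w.1 - w.2.1, μ • w.2.1 - S.vol w.1, μ • w.2.2 - 0) := fun _ => rfl
  rw [Module.End.isUnit_iff]
  constructor
  · rw [← LinearMap.ker_eq_bot, LinearMap.ker_eq_bot']
    rintro ⟨ν₁, ν₂, z⟩ hw
    rw [happY] at hw
    simp only [Prod.mk_eq_zero, sub_zero, smul_eq_zero, hμ, false_or] at hw
    obtain ⟨h1, h2, rfl⟩ := hw
    have h3 : ν₂ = μ • ν₁ := (sub_eq_zero.1 h1).symm
    have h4 : ν₁ = 0 := by
      refine (LinearMap.ker_eq_bot'.1 (LinearMap.ker_eq_bot.2 hb.1)) ν₁ ?_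
      rw [happ, ← h2, h3, smul_smul, sq]
    simp [h3, h4]
  · rintro ⟨f₁, f₂, f₃⟩
    obtain ⟨ν₁, hν⟩ := hb.2 (f₂ + μ • f₁)
    refine ⟨(ν₁, μ • ν₁ - f₁, μ⁻¹ • f₃), ?_⟩
    rw [happ] at hν
    rw [happY]
    refine Prod.ext (by simp) (Prod.ext ?_ (by simp [smul_smul, hμ]))
    simp only [smul_sub, smul_smul, ← sq]
    rw [sub_right_comm, hν, add_sub_cancel_right]

end VolterraEstimates

/-! ### The linearization as a restriction of an operator on Lebesgue spaces -/

section Splitting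

variable {n : ℕ} (S : System n)

theorem System.volIoo_two_eq :
    volIoo (-2 * S.T) 0 = volIoo (-2 * S.T) (-S.T) + volIoo (-S.T) 0 :=
  volIoo_add_volIoo (by linarith [S.T_pos]) (by linarith [S.T_pos])

theorem System.measurePreserving_shift :
    MeasurePreserving (fun θ : ℝ => θ - S.T) (volIoo (-S.T) 0) (volIoo (-2 * S.T) (-S.T)) := by
  simpa [sub_eq_add_neg] using measurePreserving_add_volIoo (a' := -S.T) (b' := 0)
    (a := -2 * S.T) (b := -S.T) (-S.T) (by ring) (by ring)

theorem System.measurableEmbedding_shift : MeasurableEmbedding fun θ : ℝ => θ - S.T :=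
  (MeasurableEquiv.subRight S.T).measurableEmbedding

theorem System.ae_two_iff {Q : ℝ → Prop} : (∀ᵐ θ ∂volIoo (-2 * S.T) 0, Q θ) ↔
    (∀ᵐ θ ∂volIoo (-S.T) 0, Q (θ - S.T)) ∧ ∀ᵐ θ ∂volIoo (-S.T) 0, Q θ := by
  rw [S.volIoo_two_eq, ae_add_measure_iff, ← S.measurePreserving_shift.map_eq,
    S.measurableEmbedding_shift.ae_map_iff]

theorem System.memLp_shift {f : ℝ → Fin (n + 1) → ℂ} (hf : MemLp f S.q (volIoo (-2 * S.T) 0)) :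
    MemLp (fun θ => f (θ - S.T)) S.q (volIoo (-S.T) 0) := by
  refine MemLp.comp_measurePreserving (ν := volIoo (-2 * S.T) (-S.T)) ?_ S.measurePreserving_shift
  exact hf.mono_measure (S.volIoo_two_eq ▸ Measure.le_add_right le_rfl)

theorem System.memLp_right {f : ℝ → Fin (n + 1) → ℂ} (hf : MemLp f S.q (volIoo (-2 * S.T) 0)) :
    MemLp f S.q (volIoo (-S.T) 0) :=
  hf.mono_measure (S.volIoo_two_eq ▸ Measure.le_add_left le_rfl)

/-- The part of a function on `(-2T, 0)` over `(-2T, -T)`, shifted to `(-T, 0)`. -/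
def System.leftPart : S.LpC (-2 * S.T) 0 →L[ℂ] S.LpC (-S.T) 0 :=
  LinearMap.mkContinuous
    { toFun := fun f => (S.memLp_shift (Lp.memLp f)).toLp _
      map_add' := fun f g => by
        rw [← MemLp.toLp_add]
        exact MemLp.toLp_congr _ _ (S.ae_two_iff.1 (Lp.coeFn_add f g)).1
      map_smul' := fun c f => by
        rw [RingHom.id_apply, ← MemLp.toLp_const_smul]
        exact MemLp.toLp_congr _ _ (S.ae_two_iff.1 (Lp.coeFn_smul c f)).1 } 1 fun f => by
    have hle : volIoo (-2 * S.T) (-S.T) ≤ volIoo (-2 * S.T) 0 :=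
      S.volIoo_two_eq ▸ Measure.le_add_right le_rfl
    rw [one_mul, Lp.norm_def]
    refine (Lp.norm_toLp _ (S.memLp_shift (Lp.memLp f))).trans_le ?_
    refine ENNReal.toReal_mono (Lp.eLpNorm_ne_top f) ?_
    have h := eLpNorm_comp_measurePreserving (p := S.q)
      ((Lp.aestronglyMeasurable f).mono_measure hle) S.measurePreserving_shift
    exact h.trans_le (eLpNorm_mono_measure _ hle)

/-- The restriction to `(-T, 0)` of a function on `(-2T, 0)`. -/
def System.rightPart : S.LpC (-2 * S.T) 0 →L[ℂ] S.LpC (-S.T) 0 :=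
  LinearMap.mkContinuous
    { toFun := fun f => (S.memLp_right (Lp.memLp f)).toLp _
      map_add' := fun f g => by
        rw [← MemLp.toLp_add]
        exact MemLp.toLp_congr _ _ (S.ae_two_iff.1 (Lp.coeFn_add f g)).2
      map_smul' := fun c f => by
        rw [RingHom.id_apply, ← MemLp.toLp_const_smul]
        exact MemLp.toLp_congr _ _ (S.ae_two_iff.1 (Lp.coeFn_smul c f)).2 } 1 fun f => by
    have hle : volIoo (-S.T) 0 ≤ volIoo (-2 * S.T) 0 :=
      S.volIoo_two_eq ▸ Measure.le_add_left le_rfl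
    rw [one_mul, Lp.norm_def]
    refine (Lp.norm_toLp _ (S.memLp_right (Lp.memLp f))).trans_le ?_
    exact ENNReal.toReal_mono (Lp.eLpNorm_ne_top f) (eLpNorm_mono_measure _ hle)

theorem System.coeFn_leftPart (f : S.LpC (-2 * S.T) 0) :
    ∀ᵐ θ ∂volIoo (-S.T) 0, S.leftPart f θ = f (θ - S.T) :=
  (S.memLp_shift (Lp.memLp f)).coeFn_toLp

theorem System.coeFn_rightPart (f : S.LpC (-2 * S.T) 0) :
    ∀ᵐ θ ∂volIoo (-S.T) 0, S.rightPart f θ = f θ :=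
  (S.memLp_right (Lp.memLp f)).coeFn_toLp

theorem System.ext_parts {f g : S.LpC (-2 * S.T) 0} (hl : S.leftPart f = S.leftPart g)
    (hr : S.rightPart f = S.rightPart g) : f = g := by
  refine Lp.ext (S.ae_two_iff.2 ⟨?_, ?_⟩)
  · filter_upwards [S.coeFn_leftPart f, S.coeFn_leftPart g] with θ h1 h2
    rw [← h1, ← h2, hl]
  · filter_upwards [S.coeFn_rightPart f, S.coeFn_rightPart g] with θ h1 h2
    rw [← h1, ← h2, hr]

/-- The embedding of `𝔹 × ℂ^{N-1}` into `L_p(-T, 0) × L_p(-T, 0) × ℂ^{N-1}` which cuts a function on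
`(-2T, 0)` into its two halves. -/
def System.embed : (S.BSpace × (Fin n → ℂ)) →L[ℂ] S.YSpace :=
  ((S.leftPart ∘L System.BSpace.inclusion S) ∘L ContinuousLinearMap.fst ℂ _ _).prod
    (((S.rightPart ∘L System.BSpace.inclusion S) ∘L ContinuousLinearMap.fst ℂ _ _).prod
      (ContinuousLinearMap.snd ℂ _ _))

theorem System.embed_apply (ν : S.BSpace) (z : Fin n → ℂ) :
    S.embed (ν, z) = (S.leftPart ν.toLp, S.rightPart ν.toLp, z) := rfl

theorem System.embed_injective : Function.Injective S.embed := by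
  rintro ⟨ν, z⟩ ⟨ν', z'⟩ h
  rw [S.embed_apply, S.embed_apply, Prod.mk.injEq, Prod.mk.injEq] at h
  exact Prod.ext (Subtype.ext (S.ext_parts h.1 h.2.1)) h.2.2

theorem System.memWsp_embed (x : S.BSpace × (Fin n → ℂ)) :
    MemWsp S.p S.s (-S.σ) 0 (S.embed x).1 ∧ MemWsp S.p S.s (-S.T) 0 (S.embed x).2.1 := by
  have hT := S.T_pos
  have hσ := S.σ_pos
  have hσT := S.σ_le
  obtain ⟨ν, z⟩ := x
  have hν := ν.memB.2
  constructor
  · have h1 := (hν.mono (b' := -S.T) le_rfl (by linarith)).comp_add_right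
      (a' := -S.σ) (b' := 0) (-S.T) (by ring) (by ring)
    refine h1.congr ?_
    have hle : volIoo (-S.σ) 0 ≤ volIoo (-S.T) 0 :=
      Measure.restrict_mono (Ioo_subset_Ioo_left (by linarith)) le_rfl
    filter_upwards [ae_mono hle (S.coeFn_leftPart ν.toLp)] with θ hθ
    rw [← sub_eq_add_neg]
    exact hθ.symm
  · refine (hν.mono (a' := -S.T) (by linarith) le_rfl).congr ?_
    filter_upwards [S.coeFn_rightPart ν.toLp] with θ hθ using hθ.symm

/-- A triple whose first component is of class `W_p^s` near the end of the interval, and whose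
second component is of class `W_p^s`, comes from `𝔹 × ℂ^{N-1}`: the two halves glue. -/
theorem System.exists_embed_eq {w : S.YSpace} (h1 : MemWsp S.p S.s (-S.σ) 0 w.1)
    (h2 : MemWsp S.p S.s (-S.T) 0 w.2.1) : ∃ x, S.embed x = w := by
  have hT := S.T_pos
  have hσ := S.σ_pos
  have hσT := S.σ_le
  have hp := S.one_lt_p
  have hsp : S.s * S.p < 1 := by
    have := (lt_div_iff₀ S.s_pos).1 (lt_min_iff.1 S.p_lt).1
    linarith
  set f : ℝ → Fin (n + 1) → ℂ := fun θ => if θ < -S.T then w.1 (θ + S.T) else w.2.1 θ with hf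
  have hleft : ∀ a, (fun θ => w.1 (θ + S.T)) =ᵐ[volIoo a (-S.T)] f := fun a => by
    filter_upwards [ae_restrict_mem measurableSet_Ioo] with θ hθ
    rw [hf]; simp only; rw [if_pos hθ.2]
  have hright : w.2.1 =ᵐ[volIoo (-S.T) 0] f := by
    filter_upwards [ae_restrict_mem measurableSet_Ioo] with θ hθ
    rw [hf]; simp only; rw [if_neg (not_lt.2 hθ.1.le)]
  have hm1 : MemLp f S.q (volIoo (-2 * S.T) (-S.T)) := by
    refine (memLp_congr_ae (hleft _)).1 ?_
    exact (Lp.memLp w.1).comp_measurePreserving (measurePreserving_add_volIoo (a' := -2 * S.T)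
      (b' := -S.T) S.T (by ring) (by ring))
  have hm2 : MemLp f S.q (volIoo (-S.T) 0) := (memLp_congr_ae hright).1 (Lp.memLp w.2.1)
  have hm : MemLp f S.q (volIoo (-2 * S.T) 0) := by
    have hfm : AEStronglyMeasurable f (volIoo (-2 * S.T) 0) :=
      S.volIoo_two_eq ▸ hm1.1.add_measure hm2.1
    rw [memLp_iff_lintegral_rpow_lt_top hp hfm, S.volIoo_two_eq, lintegral_add_measure]
    exact ENNReal.add_lt_top.2 ⟨(memLp_iff_lintegral_rpow_lt_top hp hm1.1).1 hm1,
      (memLp_iff_lintegral_rpow_lt_top hp hm2.1).1 hm2⟩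
  have hW : MemWsp S.p S.s (-S.T - S.σ) 0 f := by
    refine MemWsp.glue hp S.s_pos hsp (c := -S.T) (by linarith) (by linarith) ?_ (h2.congr hright)
    exact (h1.comp_add_right S.T (by ring) (by ring)).congr (hleft _)
  have hcoe := hm.coeFn_toLp
  have hB : S.MemB (hm.toLp f) := ⟨Lp.memLp _, hW.congr (S.ae_volIoo hcoe.symm)⟩
  refine ⟨((⟨hm.toLp f, hB⟩ : S.BSub), w.2.2), Prod.ext ?_ (Prod.ext ?_ rfl)⟩
  · refine Lp.ext ?_
    filter_upwards [S.coeFn_leftPart (hm.toLp f), (S.ae_two_iff.1 hcoe).1,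
      ae_restrict_mem measurableSet_Ioo] with θ g1 g2 hθ
    refine g1.trans (g2.trans ?_)
    rw [hf]; simp only; rw [if_pos (by linarith [hθ.2]), sub_add_cancel]
  · refine Lp.ext ?_
    filter_upwards [S.coeFn_rightPart (hm.toLp f), (S.ae_two_iff.1 hcoe).2, hright] with θ g1 g2 g3
    exact g1.trans (g2.trans g3.symm)

end Splitting

section Extension

variable {n : ℕ} {S : System n} (P : PeriodicSolution S)

/-- The extension of the linearization to `L_p(-T, 0) × L_p(-T, 0) × ℂ^{N-1}`. -/
def PeriodicSolution.linExt : Module.End ℂ S.YSpace := S.calV + P.calF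

theorem PeriodicSolution.linExt_fst (w : S.YSpace) :
    (P.linExt w).1 = w.2.1 + P.cSum w • P.dphi₁ := rfl

theorem PeriodicSolution.linExt_snd (w : S.YSpace) :
    (P.linExt w).2.1 = S.vol w.1 + (P.cSum w • P.dphi₂ + S.expDR w.2.2) := rfl

theorem PeriodicSolution.linExt_thd (w : S.YSpace) :
    (P.linExt w).2.2 = projR (S.volFun w.1 0 + P.cSum w • P.dphiLeft
      + (S.expB (-S.T)).mulVec (S.DR w.2.2)) :=
  zero_add _

theorem PeriodicSolution.coeFn_dphi₁ : ∀ᵐ θ ∂volIoo (-S.T) 0, P.dphi₁ θ = P.dphi θ := by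
  have h : ∀ᵐ θ ∂volIoo (-S.T) 0, P.dphi₁ θ = P.dphi (θ + 0) := MemLp.coeFn_toLp _
  simpa using h

theorem PeriodicSolution.coeFn_dphi₂ : ∀ᵐ θ ∂volIoo (-S.T) 0, P.dphi₂ θ = P.dphi (θ - S.T) :=
  MemLp.coeFn_toLp (P.memLp_dphi (c := -S.T) (by linarith) (by linarith [S.T_pos]))

theorem System.coeFn_expDR (S : System n) (z : Fin n → ℂ) : ∀ᵐ θ ∂volIoo (-S.T) 0,
    S.expDR z θ = (S.expB (-(θ + S.T))).mulVec (S.DR z) :=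
  (S.memLp_expDR z).coeFn_toLp

theorem PeriodicSolution.coeFn_linExt_fst (w : S.YSpace) : ∀ᵐ θ ∂volIoo (-S.T) 0,
    (P.linExt w).1 θ = P.cSum w • P.dphi θ + w.2.1 θ := by
  rw [P.linExt_fst]
  filter_upwards [Lp.coeFn_add w.2.1 (P.cSum w • P.dphi₁), Lp.coeFn_smul (P.cSum w) P.dphi₁,
    P.coeFn_dphi₁] with θ h1 h2 h3
  rw [h1, Pi.add_apply, h2, Pi.smul_apply, h3]
  exact add_comm _ _

theorem PeriodicSolution.coeFn_linExt_snd (w : S.YSpace) : ∀ᵐ θ ∂volIoo (-S.T) 0,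
    (P.linExt w).2.1 θ = P.cSum w • P.dphi (θ - S.T) +
      (S.volFun w.1 θ + (S.expB (-(θ + S.T))).mulVec (S.DR w.2.2)) := by
  rw [P.linExt_snd]
  filter_upwards [Lp.coeFn_add (S.vol w.1) (P.cSum w • P.dphi₂ + S.expDR w.2.2),
    Lp.coeFn_add (P.cSum w • P.dphi₂) (S.expDR w.2.2), Lp.coeFn_smul (P.cSum w) P.dphi₂,
    P.coeFn_dphi₂, S.coeFn_expDR w.2.2, S.coeFn_vol w.1] with θ h1 h2 h3 h4 h5 h6
  rw [h1, Pi.add_apply, h2, Pi.add_apply, h3, Pi.smul_apply, h4, h5, h6]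
  abel

theorem PeriodicSolution.memWsp_linExt_snd (w : S.YSpace) :
    MemWsp S.p S.s (-S.T) 0 (P.linExt w).2.1 := by
  have h := ((P.memWsp_dphi (c := -S.T) (Or.inr rfl)).const_smul (P.cSum w)).add
    ((S.memWsp_volFun (Lp.memLp w.1)).add (S.memWsp_expDR w.2.2))
  refine h.congr ((P.coeFn_linExt_snd w).mono fun θ hθ => ?_)
  rw [hθ]
  simp [sub_eq_add_neg]

theorem PeriodicSolution.memWsp_linExt_fst (w : S.YSpace) (hw : MemWsp S.p S.s (-S.σ) 0 w.2.1) :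
    MemWsp S.p S.s (-S.σ) 0 (P.linExt w).1 := by
  have hσT : -S.T ≤ -S.σ := by linarith [S.σ_le, S.T_pos]
  have h := (((P.memWsp_dphi (c := 0) (Or.inl rfl)).mono hσT le_rfl).const_smul (P.cSum w)).add hw
  have hle : volIoo (-S.σ) 0 ≤ volIoo (-S.T) 0 :=
    Measure.restrict_mono (Ioo_subset_Ioo_left hσT) le_rfl
  refine h.congr ?_
  filter_upwards [ae_mono hle (P.coeFn_linExt_fst w)] with θ hθ
  rw [hθ]
  simp

/-- The extended linearization maps the image of `𝔹 × ℂ^{N-1}` to itself. -/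
theorem PeriodicSolution.exists_embed_eq_linExt_embed (x : S.BSpace × (Fin n → ℂ)) :
    ∃ y, S.embed y = P.linExt (S.embed x) := by
  have hσT : -S.T ≤ -S.σ := by linarith [S.σ_le, S.T_pos]
  exact S.exists_embed_eq
    (P.memWsp_linExt_fst _ ((S.memWsp_embed x).2.mono hσT le_rfl)) (P.memWsp_linExt_snd _)

/-- The square of the extended linearization maps everything to the image of `𝔹 × ℂ^{N-1}`. -/
theorem PeriodicSolution.exists_embed_eq_linExt_linExt (w : S.YSpace) :
    ∃ y, S.embed y = P.linExt (P.linExt w) := by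
  have hσT : -S.T ≤ -S.σ := by linarith [S.σ_le, S.T_pos]
  exact S.exists_embed_eq
    (P.memWsp_linExt_fst _ ((P.memWsp_linExt_snd w).mono hσT le_rfl)) (P.memWsp_linExt_snd _)

theorem PeriodicSolution.continuous_cSum : Continuous P.cSum := by
  have h1 : Continuous P.c₁ := by
    have hM : Continuous S.MLin := S.MLin.continuous_of_finiteDimensional
    exact (hM.comp S.continuous_volZero).const_smul (-(S.MC P.dphiLeft)⁻¹)
  have h2 : Continuous P.c₂ := P.c₂.continuous_of_finiteDimensional
  exact (h1.comp continuous_fst).add (h2.comp (continuous_snd.comp continuous_snd))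

theorem PeriodicSolution.continuous_linExt : Continuous P.linExt := by
  have hc := P.continuous_cSum
  have hvol : Continuous S.vol := S.volL.continuous
  have hz : Continuous fun w : S.YSpace => w.2.2 := continuous_snd.comp continuous_snd
  have h1 : Continuous fun w => (P.linExt w).1 := by
    simp only [P.linExt_fst]
    exact (continuous_fst.comp continuous_snd).add (hc.smul continuous_const)
  have h2 : Continuous fun w => (P.linExt w).2.1 := by
    simp only [P.linExt_snd]
    exact (hvol.comp continuous_fst).add ((hc.smul continuous_const).add
      (S.expDR.continuous_of_finiteDimensional.comp hz))
  have h3 : Continuous fun w => (P.linExt w).2.2 := by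
    simp only [P.linExt_thd]
    have hp : Continuous (projRLin : (Fin (n + 1) → ℂ) →ₗ[ℂ] (Fin n → ℂ)) :=
      projRLin.continuous_of_finiteDimensional
    have hd : Continuous ((S.expB (-S.T)).mulVecLin ∘ₗ S.DRLin) :=
      LinearMap.continuous_of_finiteDimensional _
    exact hp.comp (((S.continuous_volZero.comp continuous_fst).add
      (hc.smul continuous_const)).add (hd.comp hz))
  exact h1.prodMk (h2.prodMk h3)

theorem System.continuousOn_volFun (S : System n) {ν : ℝ → Fin (n + 1) → ℂ}
    (hν : MemLp ν S.q (volIoo (-S.T) 0)) : ContinuousOn (S.volFun ν) (Icc (-S.T) 0) := by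
  have hle : -S.T ≤ 0 := by linarith [S.T_pos]
  have h0 : ContinuousOn (fun θ => (S.expB (-θ)).mulVec
      (∫ ξ in (-S.T)..θ, (S.expB ξ).mulVec (S.AC.mulVec (ν ξ)))) (Icc (-S.T) 0) := by
    have h := S.intervalIntegrable_kernel hν (left_mem_Icc.2 hle) (right_mem_Icc.2 hle) 0
    simp only [sub_zero] at h
    have hi := intervalIntegral.continuousOn_primitive_interval' h left_mem_uIcc
    rw [uIcc_of_le hle] at hi
    have he : ContinuousOn (fun θ => S.expB (-θ)) (Icc (-S.T) 0) :=
      (S.continuous_expB.comp continuous_neg).continuousOn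
    rw [continuousOn_iff_continuous_domRestrict] at hi he ⊢
    exact he.matrix_mulVec hi
  exact h0.congr fun θ hθ => S.volFun_eq hν hθ

theorem System.volFun_leftPart (S : System n) (f : S.LpC (-2 * S.T) 0) {θ : ℝ}
    (hθ : θ ∈ Icc (-S.T) 0) :
    S.volFun (S.leftPart f) θ =
      ∫ ξ in (-S.T)..θ, (S.expB (ξ - θ)).mulVec (S.AC.mulVec (f (ξ - S.T))) :=
  S.volFun_congr (S.coeFn_leftPart f) hθ

theorem PeriodicSolution.dHit_eq_cSum (ν : S.BSpace) (z : Fin n → ℂ) :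
    P.dHit ν.toLp (S.DR z) = P.cSum (S.embed (ν, z)) := by
  have h0 : (0 : ℝ) ∈ Icc (-S.T) 0 := right_mem_Icc.2 (by linarith [S.T_pos])
  have h : P.cSum (S.embed (ν, z)) = -(S.MC P.dphiLeft)⁻¹ * S.MLin (S.volFun (S.leftPart ν.toLp) 0)
      + -(S.MC P.dphiLeft)⁻¹ * S.MLin ((S.expB (-S.T)).mulVec (S.DR z)) := rfl
  rw [h, ← mul_add, ← map_add, S.volFun_leftPart _ h0]
  simp only [sub_zero]
  rfl

theorem PeriodicSolution.linFun_left (ν : S.BSpace) (z : Fin n → ℂ) :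
    ∀ᵐ θ ∂volIoo (-S.T) 0,
      P.linFun ν.toLp (S.DR z) (θ - S.T) = (P.linExt (S.embed (ν, z))).1 θ := by
  filter_upwards [P.coeFn_linExt_fst (S.embed (ν, z)), S.coeFn_rightPart ν.toLp,
    ae_restrict_mem measurableSet_Ioo] with θ h1 h2 hθ
  have hlt : θ - S.T < -S.T := by linarith [hθ.2]
  rw [h1, PeriodicSolution.linFun, P.dHit_eq_cSum, PeriodicSolution.dtFlow, System.dFlow,
    if_pos hlt, if_pos hlt, sub_add_cancel, S.embed_apply]
  simp only
  rw [h2]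

theorem PeriodicSolution.linFun_of_mem (ν : S.BSpace) (z : Fin n → ℂ) {θ : ℝ}
    (hθ : θ ∈ Ioo (-S.T) 0) :
    P.linFun ν.toLp (S.DR z) θ = P.cSum (S.embed (ν, z)) • P.dphi (θ - S.T) +
      (S.volFun (S.leftPart ν.toLp) θ + (S.expB (-(θ + S.T))).mulVec (S.DR z)) := by
  have hlt : ¬ θ < -S.T := not_lt.2 hθ.1.le
  rw [PeriodicSolution.linFun, P.dHit_eq_cSum, PeriodicSolution.dtFlow, System.dFlow,
    if_neg hlt, if_neg hlt, S.volFun_leftPart _ (Ioo_subset_Icc_self hθ)]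

theorem PeriodicSolution.linFun_right (ν : S.BSpace) (z : Fin n → ℂ) :
    ∀ᵐ θ ∂volIoo (-S.T) 0,
      P.linFun ν.toLp (S.DR z) θ = (P.linExt (S.embed (ν, z))).2.1 θ := by
  filter_upwards [P.coeFn_linExt_snd (S.embed (ν, z)), ae_restrict_mem measurableSet_Ioo]
    with θ h1 hθ
  rw [h1, P.linFun_of_mem ν z hθ]
  rfl

theorem PeriodicSolution.tendsto_linFun (ν : S.BSpace) (z : Fin n → ℂ) :
    ∃ w, Tendsto (P.linFun ν.toLp (S.DR z)) (𝓝[<] 0) (𝓝 w) ∧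
      projR w = (P.linExt (S.embed (ν, z))).2.2 := by
  have hT := S.T_pos
  have hI : Ioo (-S.T) 0 ∈ 𝓝[<] (0 : ℝ) := Ioo_mem_nhdsLT (by linarith)
  refine ⟨P.cSum (S.embed (ν, z)) • P.dphiLeft + (S.volFun (S.leftPart ν.toLp) 0
    + (S.expB (-(0 + S.T))).mulVec (S.DR z)), ?_, ?_⟩
  · have h1 : Tendsto (fun θ : ℝ => θ - S.T) (𝓝[<] 0) (𝓝[<] (-S.T)) := by
      refine tendsto_nhdsWithin_of_tendsto_nhds_of_eventually_within _ ?_ ?_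
      · have : Tendsto (fun θ : ℝ => θ - S.T) (𝓝 0) (𝓝 (0 - S.T)) :=
          (continuous_id.sub continuous_const).tendsto 0
        rw [zero_sub] at this
        exact this.mono_left nhdsWithin_le_nhds
      · filter_upwards [self_mem_nhdsWithin] with θ hθ
        have : θ < 0 := hθ
        exact (by linarith : θ - S.T < -S.T)
    have h2 : Tendsto (S.volFun (S.leftPart ν.toLp)) (𝓝[<] 0)
        (𝓝 (S.volFun (S.leftPart ν.toLp) 0)) := by
      have := (S.continuousOn_volFun (Lp.memLp (S.leftPart ν.toLp))) 0
        (right_mem_Icc.2 (by linarith))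
      exact this.tendsto.mono_left (le_inf nhdsWithin_le_nhds
        (le_principal_iff.2 (mem_of_superset hI Ioo_subset_Icc_self)))
    have h3 : Tendsto (fun θ => (S.expB (-(θ + S.T))).mulVec (S.DR z)) (𝓝[<] 0)
        (𝓝 ((S.expB (-(0 + S.T))).mulVec (S.DR z))) := by
      have hc : Continuous fun θ => (S.expB (-(θ + S.T))).mulVec (S.DR z) :=
        (S.continuous_expB.comp (by fun_prop)).matrix_mulVec continuous_const
      exact (hc.tendsto 0).mono_left nhdsWithin_le_nhds
    refine (((P.tendsto_dphi.comp h1).const_smul _).add (h2.add h3)).congr' ?_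
    filter_upwards [hI] with θ hθ
    rw [P.linFun_of_mem ν z hθ]
    rfl
  · rw [P.linExt_thd, S.embed_apply, zero_add]
    congr 1
    rw [add_left_comm, add_assoc]

/-- The formal linearization is the restriction of its extension. -/
theorem PeriodicSolution.isLPi_iff {L : (S.BSpace × (Fin n → ℂ)) →L[ℂ] (S.BSpace × (Fin n → ℂ))} :
    P.IsLPi L ↔ ∀ x, S.embed (L x) = P.linExt (S.embed x) := by
  constructor
  · rintro h ⟨ν, z⟩
    obtain ⟨h1, w, hw, h2⟩ := h ν z
    obtain ⟨h3, h4⟩ := S.ae_two_iff.1 h1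
    refine Prod.ext (Lp.ext ?_) (Prod.ext (Lp.ext ?_) ?_)
    · filter_upwards [S.coeFn_leftPart (L (ν, z)).1.toLp, h3, P.linFun_left ν z] with θ g1 g2 g3
      exact g1.trans (g2.trans g3)
    · filter_upwards [S.coeFn_rightPart (L (ν, z)).1.toLp, h4, P.linFun_right ν z] with θ g1 g2 g3
      exact g1.trans (g2.trans g3)
    · obtain ⟨w', hw', h5⟩ := P.tendsto_linFun ν z
      rw [← h5, ← tendsto_nhds_unique hw hw']
      exact h2
  · intro h ν z
    have hx := h (ν, z)
    have h1 : S.leftPart (L (ν, z)).1.toLp = (P.linExt (S.embed (ν, z))).1 := congrArg Prod.fst hx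
    have h2 : S.rightPart (L (ν, z)).1.toLp = (P.linExt (S.embed (ν, z))).2.1 :=
      congrArg (fun w => w.2.1) hx
    have h3 : (L (ν, z)).2 = (P.linExt (S.embed (ν, z))).2.2 := congrArg (fun w => w.2.2) hx
    obtain ⟨w, hw, h5⟩ := P.tendsto_linFun ν z
    refine ⟨S.ae_two_iff.2 ⟨?_, ?_⟩, w, hw, h3.trans h5.symm⟩
    · filter_upwards [S.coeFn_leftPart (L (ν, z)).1.toLp, P.linFun_left ν z] with θ g1 g2
      rw [g2, ← g1, h1]
    · filter_upwards [S.coeFn_rightPart (L (ν, z)).1.toLp, P.linFun_right ν z] with θ g1 g2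
      rw [g2, ← g1, h2]

end Extension

/-! ### The spectrum and the kernel of the pencil -/

section Pencil

variable {𝕜 Y : Type*} [Field 𝕜] [AddCommGroup Y] [Module 𝕜 Y]

theorem exists_ne_zero_of_ker_pencil_ne_bot {A F : Module.End 𝕜 Y} (hA : IsUnit A)
    (h : LinearMap.ker (LinearMap.id - F.rangeRestrict ∘ₗ Ring.inverse A ∘ₗ
      (LinearMap.range F).subtype) ≠ ⊥) : ∃ w ≠ 0, A w = F w := by
  obtain ⟨y, hy, hy0⟩ := (Submodule.ne_bot_iff _).1 h
  have h1 : A (Ring.inverse A y) = y := LinearMap.congr_fun (Ring.mul_inverse_cancel A hA) (y : Y)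
  have h2 : (y : Y) = F (Ring.inverse A y) := congrArg Subtype.val (sub_eq_zero.1 hy)
  refine ⟨Ring.inverse A y, fun h0 => hy0 (Subtype.ext ?_), h1.trans h2⟩
  rw [← h1, h0, map_zero]
  rfl

/-- For a perturbation `F` of finite rank, solving `(A - F) w = f` amounts to solving a linear
equation for `F w` on the range of `F`. -/
theorem bijective_sub_of_ker_pencil_eq_bot {A F : Module.End 𝕜 Y} (hA : IsUnit A)
    [FiniteDimensional 𝕜 (LinearMap.range F)]
    (h : LinearMap.ker (LinearMap.id - F.rangeRestrict ∘ₗ Ring.inverse A ∘ₗ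
      (LinearMap.range F).subtype) = ⊥) : Function.Bijective (A - F) := by
  have hl : ∀ w, Ring.inverse A (A w) = w := LinearMap.congr_fun (Ring.inverse_mul_cancel A hA)
  have hr : ∀ w, A (Ring.inverse A w) = w := LinearMap.congr_fun (Ring.mul_inverse_cancel A hA)
  constructor
  · rw [← LinearMap.ker_eq_bot, LinearMap.ker_eq_bot']
    intro w hw
    have hw' : A w = F w := sub_eq_zero.1 hw
    have hy : F.rangeRestrict w = 0 := by
      refine (LinearMap.ker_eq_bot'.1 h) _ (sub_eq_zero.2 (Subtype.ext ?_))
      change F w = F (Ring.inverse A (F w))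
      rw [← hw', hl, hw']
    rw [← hl w, hw']
    have : F w = 0 := congrArg Subtype.val hy
    rw [this, map_zero]
  · intro f
    obtain ⟨g, hg⟩ := (LinearMap.injective_iff_surjective.1 (LinearMap.ker_eq_bot.1 h))
      (F.rangeRestrict (Ring.inverse A f))
    have hg' : (g : Y) - F (Ring.inverse A g) = F (Ring.inverse A f) := congrArg Subtype.val hg
    refine ⟨Ring.inverse A (f + g), ?_⟩
    change A (Ring.inverse A (f + g)) - F (Ring.inverse A (f + g)) = f
    rw [hr, map_add, map_add, ← hg']
    abel

end Pencil

section Spectrum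

variable {n : ℕ} {S : System n} (P : PeriodicSolution S)

/-- `𝓕` depends on its argument only through `c`, `(V ν₁)(0)` and `z`. -/
instance PeriodicSolution.finiteDimensional_range_calF :
    FiniteDimensional ℂ (LinearMap.range P.calF) := by
  let c : (ℂ × (Fin (n + 1) → ℂ) × (Fin n → ℂ)) →ₗ[ℂ] ℂ := LinearMap.fst ℂ _ _
  let v : (ℂ × (Fin (n + 1) → ℂ) × (Fin n → ℂ)) →ₗ[ℂ] (Fin (n + 1) → ℂ) :=
    LinearMap.fst ℂ _ _ ∘ₗ LinearMap.snd ℂ _ _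
  let z : (ℂ × (Fin (n + 1) → ℂ) × (Fin n → ℂ)) →ₗ[ℂ] (Fin n → ℂ) :=
    LinearMap.snd ℂ _ _ ∘ₗ LinearMap.snd ℂ _ _
  let g : (ℂ × (Fin (n + 1) → ℂ) × (Fin n → ℂ)) →ₗ[ℂ] S.YSpace :=
    (c.smulRight P.dphi₁).prod ((c.smulRight P.dphi₂ + S.expDR ∘ₗ z).prod
      (projRLin ∘ₗ (v + c.smulRight P.dphiLeft + (S.expB (-S.T)).mulVecLin ∘ₗ S.DRLin ∘ₗ z)))
  refine Submodule.finiteDimensional_of_le (S₂ := LinearMap.range g) ?_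
  rintro _ ⟨w, rfl⟩
  exact ⟨(P.cSum w, S.volZero w.1, w.2.2), rfl⟩

theorem PeriodicSolution.existsUnique_isLPi :
    ∃! L : (S.BSpace × (Fin n → ℂ)) →L[ℂ] (S.BSpace × (Fin n → ℂ)), P.IsLPi L := by
  have hinj : Function.Injective S.embed.toLinearMap := S.embed_injective
  have hmem : ∀ x, (P.linExt ∘ₗ S.embed.toLinearMap) x ∈ LinearMap.range S.embed.toLinearMap :=
    fun x => P.exists_embed_eq_linExt_embed x
  let L₀ : (S.BSpace × (Fin n → ℂ)) →ₗ[ℂ] (S.BSpace × (Fin n → ℂ)) :=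
    (LinearEquiv.ofInjective _ hinj).symm.toLinearMap ∘ₗ
      (P.linExt ∘ₗ S.embed.toLinearMap).codRestrict _ hmem
  have hL₀ : ∀ x, S.embed (L₀ x) = P.linExt (S.embed x) := fun x =>
    congrArg Subtype.val ((LinearEquiv.ofInjective _ hinj).apply_symm_apply
      ((P.linExt ∘ₗ S.embed.toLinearMap).codRestrict _ hmem x))
  -- boundedness follows from the closed graph theorem, as the extension is continuous
  have hcont : Continuous L₀ := by
    refine LinearMap.continuous_of_seq_closed_graph L₀ fun u x y hu hy => S.embed_injective ?_
    have h1 := (S.embed.continuous.tendsto y).comp hy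
    have h2 := ((P.continuous_linExt.comp S.embed.continuous).tendsto x).comp hu
    rw [hL₀]
    refine tendsto_nhds_unique h1 (h2.congr fun k => ?_)
    exact (hL₀ (u k)).symm
  refine ⟨⟨L₀, hcont⟩, P.isLPi_iff.2 hL₀, fun L hL => ?_⟩
  refine ContinuousLinearMap.ext fun x => ?_
  exact S.embed_injective ((P.isLPi_iff.1 hL x).trans (hL₀ x).symm)

/-- Outside zero, the linearization and its extension have the same eigenvectors and the same
resolvent set, because the square of the extension maps into the image of `𝔹 × ℂ^{N-1}`. -/
theorem PeriodicSolution.mem_spectrum_iff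
    {L : (S.BSpace × (Fin n → ℂ)) →L[ℂ] (S.BSpace × (Fin n → ℂ))} (hL : P.IsLPi L) {μ : ℂ}
    (hμ : μ ≠ 0) : μ ∈ spectrum ℂ L ↔ LinearMap.ker (P.pencil μ) ≠ ⊥ := by
  rw [P.isLPi_iff] at hL
  have hμ2 : μ ^ 2 ≠ 0 := pow_ne_zero 2 hμ
  have hA := S.isUnit_sub_calV hμ
  have hsub : ∀ w, (algebraMap ℂ (Module.End ℂ S.YSpace) μ - S.calV - P.calF) w
      = μ • w - P.linExt w := fun w => sub_sub _ _ _
  have hLsub : ∀ x, (algebraMap ℂ ((S.BSpace × (Fin n → ℂ)) →L[ℂ] (S.BSpace × (Fin n → ℂ))) μ - L) x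
      = μ • x - L x := fun x => rfl
  have hcomm : ∀ x, S.embed (μ • x - L x) = μ • S.embed x - P.linExt (S.embed x) := fun x => by
    rw [map_sub, map_smul, hL]
  rw [spectrum.mem_iff, ContinuousLinearMap.isUnit_iff_bijective]
  constructor
  · intro hnot hker
    have hbij := bijective_sub_of_ker_pencil_eq_bot hA hker
    refine hnot ⟨?_, fun f => ?_⟩
    · intro x x' hxx
      rw [hLsub, hLsub] at hxx
      refine S.embed_injective (hbij.1 ?_)
      rw [hsub, hsub, ← hcomm, ← hcomm, hxx]
    · obtain ⟨w, hw⟩ := hbij.2 (S.embed f)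
      rw [hsub] at hw
      obtain ⟨y, hy⟩ := P.exists_embed_eq_linExt_linExt w
      have h1 : P.linExt w = μ • w - S.embed f := by rw [← hw, sub_sub_cancel]
      have h2 : μ ^ 2 • w = S.embed (y + μ • f + L f) := by
        rw [map_add, map_add, map_smul, hy, hL, h1, map_sub, map_smul, h1, smul_sub, smul_smul, sq]
        abel
      refine ⟨(μ ^ 2)⁻¹ • (y + μ • f + L f), S.embed_injective ?_⟩
      rw [hLsub, hcomm, map_smul, ← h2, inv_smul_smul₀ hμ2, hw]
  · intro hker hbij
    obtain ⟨w, hw0, hw⟩ := exists_ne_zero_of_ker_pencil_ne_bot hA hker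
    have h1 : P.linExt w = μ • w := by
      have h2 := hsub w
      rw [LinearMap.sub_apply, hw, sub_self] at h2
      exact (sub_eq_zero.1 h2.symm).symm
    obtain ⟨y, hy⟩ := P.exists_embed_eq_linExt_linExt w
    rw [h1, map_smul, h1, smul_smul, ← sq] at hy
    have hwy : S.embed ((μ ^ 2)⁻¹ • y) = w := by rw [map_smul, hy, inv_smul_smul₀ hμ2]
    refine hw0 ?_
    rw [← hwy, hbij.1 (a₁ := (μ ^ 2)⁻¹ • y) (a₂ := 0) ?_, map_zero]
    rw [map_zero, hLsub]
    refine S.embed_injective ?_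
    rw [hcomm, hwy, h1, sub_self, map_zero]

end Spectrum

end HystDelay

end

theorem corollary6p10 {n : ℕ} (S : HystDelay.System n) (P : HystDelay.PeriodicSolution S) :
    (∃! L : (S.BSpace × (Fin n → ℂ)) →L[ℂ] (S.BSpace × (Fin n → ℂ)), P.IsLPi L) ∧
    ∀ L : (S.BSpace × (Fin n → ℂ)) →L[ℂ] (S.BSpace × (Fin n → ℂ)), P.IsLPi L →
      ∀ μ : ℂ, μ ≠ 0 →
        IsUnit (algebraMap ℂ (Module.End ℂ S.YSpace) μ - S.calV) ∧
        (μ ∈ spectrum ℂ L ↔ LinearMap.ker (P.pencil μ) ≠ ⊥) := by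
  exact ⟨P.existsUnique_isLPi, fun L hL μ hμ => ⟨S.isUnit_sub_calV hμ, P.mem_spectrum_iff hL hμ⟩⟩
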